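/- Let $(\mathfrak H,(\cdot,\cdot))$ be a complex Hilbert space with a non-trivial fundamental symmetry $J$, i.e. $J$ is bounded, $J=J^*$, $J^2=I$ and $J\neq\pm I$. Put $[x,y]=(Jx,y)$ and $\mathfrak H_\pm=\frac12(I\pm J)\mathfrak H$. Let $S$ be a closed densely defined symmetric operator in $\mathfrak H$ with $SJ=JS$, and let $S_\pm=S\upharpoonright_{\mathfrak H_\pm}$, which are closed densely defined symmetric operators in $\mathfrak H_\pm$. Assume that $S_+$ and $S_-$ both have deficiency indices $\langle 1,1\rangle$, i.e. the four spaces $\ker(S_\pm^*-iI)$ and $\ker(S_\pm^*+iI)$ are one-dimensional. For a closed densely defined symmetric operator $T$ and $\mu\in\mathbb C_+=\{\mu:\operatorname{Im}\mu>0\}$ let $A_\mu$ be the restriction of $T^*$ to $\mathcal D(T)\dotplus\ker(T^*-\mu I)$. The Straus characteristic function of $T$ is $$\mathsf{Sh}_T(\mu)=(A_\mu-iI)(A_\mu+iI)^{-1}\upharpoonright_{\ker(T^*-iI)}:\ \ker(T^*-iI)\to\ker(T^*+iI),\qquad \mu\in\mathbb C_+ .$$ Let $e_{++},e_{-+},e_{+-},e_{--}$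 be vectors of equal norm spanning $\ker(S_+^*-iI)$, $\ker(S_+^*+iI)$, $\ker(S_-^*-iI)$, $\ker(S_-^*+iI)$ respectively, and let $s_\pm:\mathbb C_+\to\mathbb C$ be the functions determined by $$\mathsf{Sh}_{S_+}(\mu)e_{++}=s_+(\mu)e_{-+},\qquad \mathsf{Sh}_{S_-}(\mu)e_{+-}=s_-(\mu)e_{--},\qquad \mu\in\mathbb C_+ .$$ Then there exists a $J$-self-adjoint extension $A\supset S$ (a densely defined operator equal to its adjoint with respect to $[\cdot,\cdot]$) with empty resolvent set if and only if $s_+\approx s_-$, i.e. if and only if there is a constant $c\in\mathbb C$ with $|c|=1$ such that $c\,s_+(\mu)=s_-(\mu)$ for all $\mu\in\mathbb C_+$. -/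

import Mathlib

open scoped LinearPMap

noncomputable section

namespace KreinExt

section Hilbert

variable {H : Type*} [NormedAddCommGroup H] [InnerProductSpace ℂ H]

/-! ### Unbounded operators in a Hilbert space -/

/-- Closed densely defined symmetric operators. -/
structure IsClosedSymmetric (T : H →ₗ.[ℂ] H) : Prop where
  dense : Dense (T.domain : Set H)
  closed : T.IsClosed
  symmetric : T.IsFormalAdjoint T

/-- The resolvent set of an operator: those `μ` for which `A - μ` maps the domain of `A` bijectively
onto the whole space, with a bounded inverse `R`. -/
def resolventSet (A : H →ₗ.[ℂ] H) : Set ℂ :=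
  {μ | ∃ R : H →L[ℂ] H,
    (∀ y : H, ∃ h : R y ∈ A.domain, A ⟨R y, h⟩ - μ • R y = y) ∧
    ∀ x : A.domain, R (A x - μ • (x : H)) = x}

/-- The restriction of an operator `T` to a subspace `K` that it leaves invariant, as an operator
in `K` with domain `D(T) ∩ K`. -/
def restrict (T : H →ₗ.[ℂ] H) (K : Submodule ℂ H)
    (hK : ∀ x : T.domain, (x : H) ∈ K → T x ∈ K) : K →ₗ.[ℂ] K where
  domain := T.domain.comap K.subtype
  toFun :=
    { toFun := fun x => ⟨T ⟨((x : K) : H), x.2⟩, hK ⟨((x : K) : H), x.2⟩ (x : K).2⟩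
      map_add' := fun x y => Subtype.ext
        (T.map_add ⟨((x : K) : H), x.2⟩ ⟨((y : K) : H), y.2⟩)
      map_smul' := fun c x => Subtype.ext (T.map_smul c ⟨((x : K) : H), x.2⟩) }

/-- `A - z` as a linear map on the domain of `A`. -/
def shift (A : H →ₗ.[ℂ] H) (z : ℂ) : A.domain →ₗ[ℂ] H :=
  A.toFun - z • A.domain.subtype

/-- A closed symmetric operator that leaves `ran P` invariant and whose domain is invariant
under the bounded operator `P` restricts to a closed symmetric operator in `ran P`. -/
theorem restrict_isClosedSymmetric {T : H →ₗ.[ℂ] H} (hT : IsClosedSymmetric T) (P : H →L[ℂ] H)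
    (hD : ∀ x ∈ T.domain, P x ∈ T.domain)
    (hK : ∀ x : T.domain, (x : H) ∈ P.range → T x ∈ P.range) :
    IsClosedSymmetric (restrict T P.range hK) where
  dense := by
    have h1 : DenseRange (fun x : H => (⟨P x, ⟨x, rfl⟩⟩ : P.range)) := by
      refine Function.Surjective.denseRange ?_
      rintro ⟨_, x, rfl⟩
      exact ⟨x, rfl⟩
    have h2 := h1.dense_image (P.continuous.subtype_mk _) hT.dense
    refine h2.mono ?_
    rintro _ ⟨x, hx, rfl⟩
    exact hD x hx
  closed := by
    have h : ((restrict T P.range hK).graph : Set (P.range × P.range)) =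
        (fun p : P.range × P.range => ((p.1 : H), (p.2 : H))) ⁻¹' (T.graph : Set (H × H)) := by
      ext ⟨a, b⟩
      simp only [SetLike.mem_coe, LinearPMap.mem_graph_iff, Set.mem_preimage]
      constructor
      · rintro ⟨y, h1, h2⟩
        exact ⟨⟨((y : P.range) : H), y.2⟩, congrArg Subtype.val h1, congrArg Subtype.val h2⟩
      · rintro ⟨y, h1, h2⟩
        have ha : (a : H) ∈ T.domain := by
          have h1' : (y : H) = a := h1
          rw [← h1']; exact y.2
        refine ⟨⟨a, ha⟩, rfl, Subtype.ext ?_⟩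
        have hy : (⟨(a : H), ha⟩ : T.domain) = y := Subtype.ext h1.symm
        change T ⟨(a : H), ha⟩ = b
        rw [hy]; exact h2
    change IsClosed ((restrict T P.range hK).graph : Set (P.range × P.range))
    rw [h]
    exact IsClosed.preimage (by fun_prop) hT.closed
  symmetric := fun x y => hT.symmetric ⟨((x : P.range) : H), x.2⟩ ⟨((y : P.range) : H), y.2⟩

theorem IsClosedSymmetric.im_inner {T : H →ₗ.[ℂ] H} (hT : IsClosedSymmetric T) (x : T.domain) :
    (inner ℂ (x : H) (T x)).im = 0 := by
  have h := hT.symmetric x x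
  rw [← inner_conj_symm] at h
  exact Complex.conj_eq_iff_im.1 h

variable [CompleteSpace H]

/-- The defect subspace `ker (T* - μ)`. -/
def defect (T : H →ₗ.[ℂ] H) (μ : ℂ) : Submodule ℂ H :=
  T†.graph.comap (LinearMap.prod LinearMap.id (μ • LinearMap.id))

/-- `T` has deficiency indices `<1,1>`. -/
def HasDeficiencyIndicesOneOne (T : H →ₗ.[ℂ] H) : Prop :=
  Module.finrank ℂ (defect T Complex.I) = 1 ∧ Module.finrank ℂ (defect T (-Complex.I)) = 1

/-- The extension `A_μ` of `T` that is the restriction of `T*` to `D(T) + ker (T* - μ)`. -/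
def dissipativeExtension (T : H →ₗ.[ℂ] H) (μ : ℂ) : H →ₗ.[ℂ] H :=
  T†.domRestrict (T.domain ⊔ defect T μ)

/-! ### The operator `A_μ + i` is bijective -/

theorem mem_defect {T : H →ₗ.[ℂ] H} {μ : ℂ} {x : H} : x ∈ defect T μ ↔ (x, μ • x) ∈ T†.graph :=
  Iff.rfl

theorem mem_adjoint_graph {T : H →ₗ.[ℂ] H} (hT : Dense (T.domain : Set H)) {x y : H} :
    (x, y) ∈ T†.graph ↔ ∀ u : T.domain, inner ℂ (T u) x = inner ℂ (u : H) y := by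
  rw [LinearPMap.adjoint_graph_eq_graph_adjoint hT, Submodule.mem_adjoint_iff]
  constructor
  · intro h u
    exact sub_eq_zero.1 (h u (T u) (T.mem_graph u))
  · intro h a b hab
    obtain ⟨u, rfl, rfl⟩ := T.mem_graph_iff.1 hab
    exact sub_eq_zero.2 (h u)

/-- The basic estimate for `(A_μ + i) (x + n)`. -/
theorem IsClosedSymmetric.estimate {T : H →ₗ.[ℂ] H} (hT : IsClosedSymmetric T) {μ : ℂ}
    (x : T.domain) {n : H} (hn : n ∈ defect T μ) :
    μ.im * ‖n‖ ^ 2 + ‖(x : H) + n‖ ^ 2 ≤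
      ‖(x : H) + n‖ * ‖T x + Complex.I • (x : H) + (μ + Complex.I) • n‖ := by
  set f := T x + Complex.I • (x : H) + (μ + Complex.I) • n with hf
  have h1 : (inner ℂ ((x : H) + n) f).im = μ.im * ‖n‖ ^ 2 + ‖(x : H) + n‖ ^ 2 := by
    have hdec : f = (T x + μ • n) + Complex.I • ((x : H) + n) := by
      rw [hf]; module
    have hx := hT.im_inner x
    have hc : inner ℂ n (T x) = (starRingEnd ℂ) (inner ℂ (x : H) (μ • n)) := by
      rw [← (mem_adjoint_graph hT.dense).1 (mem_defect.1 hn) x, inner_conj_symm]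
    have hnn : (inner ℂ n (μ • n)).im = μ.im * ‖n‖ ^ 2 := by
      rw [inner_smul_right, inner_self_eq_norm_sq_to_K]
      simp [Complex.mul_im, ← Complex.ofReal_pow]
    have hii : (inner ℂ ((x : H) + n) (Complex.I • ((x : H) + n))).im = ‖(x : H) + n‖ ^ 2 := by
      rw [inner_smul_right, inner_self_eq_norm_sq_to_K]
      simp [Complex.mul_im, ← Complex.ofReal_pow]
    rw [hdec, inner_add_right, Complex.add_im, hii, inner_add_left, inner_add_right,
      inner_add_right, hc]
    simp only [Complex.add_im, Complex.conj_im, hx, hnn]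
    ring
  rw [← h1]
  exact (Complex.abs_im_le_norm _ |> (le_abs_self _).trans).trans (norm_inner_le_norm _ _)

theorem IsClosedSymmetric.bound {T : H →ₗ.[ℂ] H} (hT : IsClosedSymmetric T) {μ : ℂ}
    (hμ : 0 < μ.im) (x : T.domain) {n : H} (hn : n ∈ defect T μ) :
    ‖(x : H) + n‖ ≤ ‖T x + Complex.I • (x : H) + (μ + Complex.I) • n‖ ∧
    μ.im * ‖n‖ ^ 2 ≤ ‖T x + Complex.I • (x : H) + (μ + Complex.I) • n‖ ^ 2 := by
  have h := hT.estimate x hn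
  set a := ‖(x : H) + n‖
  set b := ‖T x + Complex.I • (x : H) + (μ + Complex.I) • n‖
  have ha : 0 ≤ a := norm_nonneg _
  have hb : 0 ≤ b := norm_nonneg _
  have hc : 0 ≤ μ.im * ‖n‖ ^ 2 := by positivity
  have hab : a ≤ b := by
    by_contra hlt
    push Not at hlt
    nlinarith
  exact ⟨hab, by nlinarith⟩

theorem IsClosedSymmetric.isClosed_range {T : H →ₗ.[ℂ] H} (hT : IsClosedSymmetric T) {μ : ℂ}
    (hμ : 0 < μ.im) (N : Submodule ℂ H) (hN : N ≤ defect T μ) (hNc : IsClosed (N : Set H)) :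
    IsClosed {f : H | ∃ (x : T.domain) (n : H), n ∈ N ∧
      f = T x + Complex.I • (x : H) + (μ + Complex.I) • n} := by
  have : CompleteSpace T.graph := hT.closed.completeSpace_coe
  have : CompleteSpace N := hNc.completeSpace_coe
  let F : (T.graph × N) →L[ℂ] H :=
    (ContinuousLinearMap.snd ℂ H H + Complex.I • ContinuousLinearMap.fst ℂ H H) ∘L
      T.graph.subtypeL ∘L ContinuousLinearMap.fst ℂ T.graph N +
    (μ + Complex.I) • (N.subtypeL ∘L ContinuousLinearMap.snd ℂ T.graph N)
  have hF : ∀ p : T.graph × N, F p =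
      (p.1 : H × H).2 + Complex.I • (p.1 : H × H).1 + (μ + Complex.I) • (p.2 : H) := fun p => rfl
  set c : ℝ := (Real.sqrt μ.im)⁻¹ with hcdef
  have hs : 0 < Real.sqrt μ.im := Real.sqrt_pos.2 hμ
  have hc : 0 < c := inv_pos.2 hs
  let K : ℝ := 2 + c + ‖μ + Complex.I‖ * c
  have hK : 0 ≤ K := by positivity
  have hb : ∀ p, ‖p‖ ≤ (⟨K, hK⟩ : NNReal) * ‖F p‖ := by
    rintro ⟨⟨⟨a, b⟩, hab⟩, ⟨n, hn⟩⟩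
    obtain ⟨x, rfl, rfl⟩ := T.mem_graph_iff.1 hab
    obtain ⟨h1, h2⟩ := hT.bound hμ x (hN hn)
    have hFp := hF ⟨⟨⟨(x : H), T x⟩, hab⟩, ⟨n, hn⟩⟩
    rw [hFp]
    set f := T x + Complex.I • (x : H) + (μ + Complex.I) • n with hf
    change _ ≤ K * ‖f‖
    have hn' : ‖n‖ ≤ c * ‖f‖ := by
      have h3 : Real.sqrt μ.im * ‖n‖ ≤ ‖f‖ := by
        refine le_of_sq_le_sq ?_ (norm_nonneg _)
        rw [mul_pow, Real.sq_sqrt hμ.le]; exact h2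
      rw [hcdef, inv_mul_eq_div, le_div_iff₀ hs]
      linarith
    have hx' : ‖(x : H)‖ ≤ (1 + c) * ‖f‖ := by
      have : (x : H) = ((x : H) + n) - n := by abel
      calc ‖(x : H)‖ = ‖((x : H) + n) - n‖ := by rw [← this]
        _ ≤ ‖(x : H) + n‖ + ‖n‖ := norm_sub_le _ _
        _ ≤ _ := by linarith
    have ht' : ‖T x‖ ≤ K * ‖f‖ := by
      have : T x = f - Complex.I • (x : H) - (μ + Complex.I) • n := by rw [hf]; abel
      calc ‖T x‖ = ‖f - Complex.I • (x : H) - (μ + Complex.I) • n‖ := by rw [← this]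
        _ ≤ ‖f‖ + ‖Complex.I • (x : H)‖ + ‖(μ + Complex.I) • n‖ :=
          (norm_sub_le _ _).trans (by gcongr; exact norm_sub_le _ _)
        _ = ‖f‖ + ‖(x : H)‖ + ‖μ + Complex.I‖ * ‖n‖ := by simp [norm_smul]
        _ ≤ ‖f‖ + (1 + c) * ‖f‖ + ‖μ + Complex.I‖ * (c * ‖f‖) := by gcongr
        _ = K * ‖f‖ := by simp only [K]; ring
    have hf0 := norm_nonneg f
    have hq : 0 ≤ ‖μ + Complex.I‖ * c * ‖f‖ := by positivity
    refine max_le (max_le ?_ ht') ?_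
    · change ‖(x : H)‖ ≤ K * ‖f‖
      refine hx'.trans ?_
      simp only [K]; nlinarith
    · change ‖n‖ ≤ K * ‖f‖
      refine hn'.trans ?_
      simp only [K]; nlinarith
  have hcl := (F.antilipschitz_of_bound hb).isClosed_range F.uniformContinuous
  convert hcl using 1
  ext f
  constructor
  · rintro ⟨x, n, hn, rfl⟩
    exact ⟨⟨⟨((x : H), T x), T.mem_graph x⟩, ⟨n, hn⟩⟩, rfl⟩
  · rintro ⟨⟨⟨⟨a, b⟩, hab⟩, ⟨n, hn⟩⟩, rfl⟩
    obtain ⟨x, rfl, rfl⟩ := T.mem_graph_iff.1 hab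
    exact ⟨x, n, hn, rfl⟩

theorem IsClosedSymmetric.isClosed_range_sub {T : H →ₗ.[ℂ] H} (hT : IsClosedSymmetric T) {z : ℂ}
    (hz : z.im ≠ 0) : IsClosed ((LinearMap.range (shift T z) : Submodule ℂ H) : Set H) := by
  have : CompleteSpace T.graph := hT.closed.completeSpace_coe
  let F : T.graph →L[ℂ] H :=
    (ContinuousLinearMap.snd ℂ H H - z • ContinuousLinearMap.fst ℂ H H) ∘L T.graph.subtypeL
  have hz' : 0 < |z.im| := abs_pos.2 hz
  let K : ℝ := 1 + (1 + ‖z‖) * |z.im|⁻¹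
  have hK : 0 ≤ K := by positivity
  have hb : ∀ p, ‖p‖ ≤ (⟨K, hK⟩ : NNReal) * ‖F p‖ := by
    rintro ⟨⟨a, b⟩, hab⟩
    obtain ⟨x, rfl, rfl⟩ := T.mem_graph_iff.1 hab
    change _ ≤ K * ‖T x - z • (x : H)‖
    set f := T x - z • (x : H) with hf
    have h1 : |z.im| * ‖(x : H)‖ ^ 2 ≤ ‖(x : H)‖ * ‖f‖ := by
      have h2 : (inner ℂ (x : H) f).im = - (z.im * ‖(x : H)‖ ^ 2) := by
        have h3 : (inner ℂ (x : H) (z • (x : H))).im = z.im * ‖(x : H)‖ ^ 2 := by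
          rw [inner_smul_right, inner_self_eq_norm_sq_to_K]
          simp [Complex.mul_im, ← Complex.ofReal_pow]
        rw [hf, inner_sub_right, Complex.sub_im, hT.im_inner, h3, zero_sub]
      have h4 := (Complex.abs_im_le_norm _).trans (norm_inner_le_norm (𝕜 := ℂ) (x : H) f)
      rwa [h2, abs_neg, abs_mul, abs_of_nonneg (by positivity : 0 ≤ ‖(x : H)‖ ^ 2)] at h4
    have hx : ‖(x : H)‖ ≤ |z.im|⁻¹ * ‖f‖ := by
      rw [inv_mul_eq_div, le_div_iff₀ hz']
      rcases (norm_nonneg (x : H)).eq_or_lt with h0 | h0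
      · rw [← h0]; simp
      · nlinarith
    have ht : ‖T x‖ ≤ K * ‖f‖ := by
      have : T x = f + z • (x : H) := by rw [hf]; abel
      calc ‖T x‖ = ‖f + z • (x : H)‖ := by rw [← this]
        _ ≤ ‖f‖ + ‖z‖ * ‖(x : H)‖ := (norm_add_le _ _).trans (by rw [norm_smul])
        _ ≤ ‖f‖ + ‖z‖ * (|z.im|⁻¹ * ‖f‖) := by gcongr
        _ ≤ K * ‖f‖ := by
          have : 0 ≤ |z.im|⁻¹ * ‖f‖ := by positivity
          simp only [K]; nlinarith
    refine max_le (hx.trans ?_) ht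
    have h5 : 0 ≤ ‖z‖ * |z.im|⁻¹ * ‖f‖ := by positivity
    have h6 := norm_nonneg f
    simp only [K]; nlinarith
  have hcl := (F.antilipschitz_of_bound hb).isClosed_range F.uniformContinuous
  convert hcl using 1
  ext f
  constructor
  · rintro ⟨x, rfl⟩
    exact ⟨⟨((x : H), T x), T.mem_graph x⟩, rfl⟩
  · rintro ⟨⟨⟨a, b⟩, hab⟩, rfl⟩
    obtain ⟨x, rfl, rfl⟩ := T.mem_graph_iff.1 hab
    exact ⟨x, rfl⟩

theorem isClosed_defect {T : H →ₗ.[ℂ] H} (hT : Dense (T.domain : Set H)) (μ : ℂ) :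
    IsClosed (defect T μ : Set H) := by
  have h : (defect T μ : Set H) = (fun x => (x, μ • x)) ⁻¹' (T†.graph : Set (H × H)) := rfl
  rw [h]
  exact IsClosed.preimage (by fun_prop) (LinearPMap.adjoint_isClosed hT)

/-- A vector orthogonal to `ran (T - conj μ)` lies in `ker (T* - μ)`. -/
theorem mem_defect_of_orthogonal {T : H →ₗ.[ℂ] H} (hT : Dense (T.domain : Set H)) {μ : ℂ} {v : H}
    (h : ∀ x : T.domain, inner ℂ (T x - (starRingEnd ℂ) μ • (x : H)) v = 0) : v ∈ defect T μ := by
  refine mem_defect.2 ((mem_adjoint_graph hT).2 fun u => ?_)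
  have h1 := h u
  rw [inner_sub_left, inner_smul_left, Complex.conj_conj, sub_eq_zero] at h1
  rw [h1, inner_smul_right]

theorem IsClosedSymmetric.exists_solution {T : H →ₗ.[ℂ] H} (hT : IsClosedSymmetric T) {μ : ℂ}
    (hμ : 0 < μ.im) (f : H) : ∃ (x : T.domain) (n : H), n ∈ defect T μ ∧
      f = T x + Complex.I • (x : H) + (μ + Complex.I) • n := by
  let R : Submodule ℂ H :=
    LinearMap.range (shift T (-Complex.I)) ⊔ (defect T μ).map ((μ + Complex.I) • LinearMap.id)
  have hR : (R : Set H) = {f : H | ∃ (x : T.domain) (n : H), n ∈ defect T μ ∧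
      f = T x + Complex.I • (x : H) + (μ + Complex.I) • n} := by
    ext g
    simp only [R, SetLike.mem_coe, Submodule.mem_sup, LinearMap.mem_range, Submodule.mem_map,
      Set.mem_ofPred_eq]
    constructor
    · rintro ⟨_, ⟨x, rfl⟩, _, ⟨n, hn, rfl⟩, rfl⟩
      refine ⟨x, n, hn, ?_⟩
      simp [shift]
    · rintro ⟨x, n, hn, rfl⟩
      refine ⟨_, ⟨x, rfl⟩, _, ⟨n, hn, rfl⟩, ?_⟩
      simp [shift]
  have hRc : IsClosed (R : Set H) :=
    hR ▸ hT.isClosed_range hμ _ le_rfl (isClosed_defect hT.dense μ)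
  have : CompleteSpace R := hRc.completeSpace_coe
  suffices h : R = ⊤ by
    have : f ∈ (R : Set H) := by rw [h]; trivial
    rw [hR] at this
    exact this
  rw [← Submodule.orthogonal_eq_bot_iff, Submodule.eq_bot_iff]
  intro v hv
  have hv1 : ∀ x : T.domain, inner ℂ (T x + Complex.I • (x : H)) v = 0 := by
    intro x
    refine (Submodule.mem_orthogonal _ _).1 hv _ (Submodule.mem_sup_left ⟨x, ?_⟩)
    simp [shift]
  have hv2 : ∀ n ∈ defect T μ, inner ℂ n v = 0 := by
    intro n hn
    have h0 : μ + Complex.I ≠ 0 := by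
      intro h
      have := congrArg Complex.im h
      simp at this
      linarith
    have h1 := (Submodule.mem_orthogonal _ _).1 hv _ (Submodule.mem_sup_right ⟨n, hn, rfl⟩)
    have h2 : (starRingEnd ℂ) (μ + Complex.I) * inner ℂ n v = 0 := by
      rw [← inner_smul_left]; exact h1
    exact (mul_eq_zero.1 h2).resolve_left ((map_ne_zero _).2 h0)
  let Q : Submodule ℂ H := LinearMap.range (shift T ((starRingEnd ℂ) μ))
  have hQc : IsClosed (Q : Set H) := hT.isClosed_range_sub (by simpa using hμ.ne')
  have : CompleteSpace Q := hQc.completeSpace_coe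
  have hvQ : v ∈ Q := by
    rw [← Submodule.orthogonal_orthogonal Q, Submodule.mem_orthogonal]
    intro n hn
    refine hv2 n (mem_defect_of_orthogonal hT.dense fun x => ?_)
    exact (Submodule.mem_orthogonal _ _).1 hn _ ⟨x, rfl⟩
  obtain ⟨x, rfl⟩ := hvQ
  have key := hv1 x
  have hsh : shift T ((starRingEnd ℂ) μ) x = T x - (starRingEnd ℂ) μ • (x : H) := rfl
  rw [hsh] at key ⊢
  have ht := hT.im_inner x
  have hsym : inner ℂ (T x) (x : H) = inner ℂ (x : H) (T x) := hT.symmetric x x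
  have hcs : ‖inner ℂ (x : H) (T x)‖ ≤ ‖(x : H)‖ * ‖T x‖ := norm_inner_le_norm _ _
  obtain ⟨t, htt⟩ : ∃ t : ℝ, inner ℂ (x : H) (T x) = (t : ℂ) :=
    ⟨_, (Complex.ext rfl (by simpa using ht))⟩
  rw [inner_add_left, inner_sub_right, inner_sub_right, inner_smul_left, inner_smul_left,
    inner_smul_right, inner_smul_right, hsym, htt, inner_self_eq_norm_sq_to_K,
    inner_self_eq_norm_sq_to_K] at key
  rw [htt, Complex.norm_real, Real.norm_eq_abs] at hcs
  have hre := congrArg Complex.re key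
  have him := congrArg Complex.im key
  simp [Complex.mul_re, Complex.mul_im, ← Complex.ofReal_pow] at hre him
  have hcs2 : t ^ 2 ≤ ‖(x : H)‖ ^ 2 * ‖T x‖ ^ 2 := by
    rw [← mul_pow, ← sq_abs]
    gcongr
  have hzero : ‖(x : H)‖ ^ 2 = 0 := by
    set a := ‖T x‖ ^ 2
    set n := ‖(x : H)‖ ^ 2
    have h1 : μ.im * (t ^ 2 + n ^ 2) ≤ 0 := by
      have h2 : n * a = (1 - μ.im) * t ^ 2 - μ.im * n ^ 2 := by
        linear_combination n * hre + t * him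
      linarith
    have h3 : t ^ 2 + n ^ 2 ≤ 0 := by
      by_contra hlt
      push Not at hlt
      linarith [mul_pos hμ hlt]
    nlinarith [sq_nonneg t, sq_nonneg n]
  have hx0 : (x : H) = 0 := by simpa using hzero
  have : x = 0 := Subtype.ext hx0
  subst this
  simp

theorem mem_dissipativeExtension_domain {T : H →ₗ.[ℂ] H} (hT : IsClosedSymmetric T) {μ : ℂ}
    {u : H} : u ∈ (dissipativeExtension T μ).domain ↔
      ∃ (x : T.domain) (n : H), n ∈ defect T μ ∧ u = (x : H) + n := by
  constructor
  · rintro ⟨h, -⟩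
    obtain ⟨x, hx, n, hn, rfl⟩ := Submodule.mem_sup.1 h
    exact ⟨⟨x, hx⟩, n, hn, rfl⟩
  · rintro ⟨x, n, hn, rfl⟩
    refine ⟨Submodule.mem_sup.2 ⟨x, x.2, n, hn, rfl⟩, ?_⟩
    exact Submodule.add_mem _ ((hT.symmetric.le_adjoint hT.dense).1 x.2)
      (LinearPMap.mem_domain_of_mem_graph (mem_defect.1 hn))

theorem dissipativeExtension_graph_le (T : H →ₗ.[ℂ] H) (μ : ℂ)
    (u : (dissipativeExtension T μ).domain) :
    ((u : H), dissipativeExtension T μ u) ∈ T†.graph :=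
  LinearPMap.le_graph_of_le LinearPMap.domRestrict_le (LinearPMap.mem_graph _ u)

theorem dissipativeExtension_apply {T : H →ₗ.[ℂ] H} (hT : IsClosedSymmetric T) {μ : ℂ}
    (u : (dissipativeExtension T μ).domain) (x : T.domain) {n : H} (hn : n ∈ defect T μ)
    (hu : (u : H) = (x : H) + n) : dissipativeExtension T μ u = T x + μ • n := by
  have h1 := dissipativeExtension_graph_le T μ u
  have h2 : ((x : H), T x) ∈ T†.graph :=
    LinearPMap.le_graph_of_le (hT.symmetric.le_adjoint hT.dense) (T.mem_graph x)
  have h3 := T†.graph.add_mem h2 (mem_defect.1 hn)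
  exact LinearPMap.mem_graph_snd_inj _ h1 h3 hu

theorem IsClosedSymmetric.bijective {T : H →ₗ.[ℂ] H} (hT : IsClosedSymmetric T) {μ : ℂ}
    (hμ : 0 < μ.im) : Function.Bijective (shift (dissipativeExtension T μ) (-Complex.I)) := by
  have hval : ∀ (u : (dissipativeExtension T μ).domain) (x : T.domain) (n : H),
      n ∈ defect T μ → (u : H) = (x : H) + n →
      shift (dissipativeExtension T μ) (-Complex.I) u =
        T x + Complex.I • (x : H) + (μ + Complex.I) • n := by
    intro u x n hn hu
    change dissipativeExtension T μ u - (-Complex.I) • (u : H) = _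
    rw [dissipativeExtension_apply hT u x hn hu, hu]
    module
  constructor
  · rw [← LinearMap.ker_eq_bot, LinearMap.ker_eq_bot']
    intro u hu
    obtain ⟨x, n, hn, hxn⟩ := (mem_dissipativeExtension_domain hT).1 u.2
    have h := (hT.bound hμ x hn).1
    rw [← hval u x n hn hxn, hu, norm_zero, ← hxn] at h
    exact Subtype.ext (norm_le_zero_iff.1 h)
  · intro f
    obtain ⟨x, n, hn, hf⟩ := hT.exists_solution hμ f
    refine ⟨⟨(x : H) + n, (mem_dissipativeExtension_domain hT).2 ⟨x, n, hn, rfl⟩⟩, ?_⟩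
    rw [hf]
    exact hval _ x n hn rfl

/-! ### The characteristic function -/

/-- The bijection `A_μ + i` from `D(A_μ)` onto the whole space. -/
def shiftEquiv {T : H →ₗ.[ℂ] H} (hT : IsClosedSymmetric T) {μ : ℂ} (hμ : 0 < μ.im) :
    (dissipativeExtension T μ).domain ≃ₗ[ℂ] H :=
  LinearEquiv.ofBijective (shift (dissipativeExtension T μ) (-Complex.I)) (hT.bijective hμ)

theorem shift_mem_defect {T : H →ₗ.[ℂ] H} (hT : IsClosedSymmetric T) {μ : ℂ} (hμ : 0 < μ.im)
    (f : defect T Complex.I) :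
    shift (dissipativeExtension T μ) Complex.I ((shiftEquiv hT hμ).symm f) ∈
      defect T (-Complex.I) := by
  set u := (shiftEquiv hT hμ).symm f with hu
  have h1 : dissipativeExtension T μ u - (-Complex.I) • (u : H) = f :=
    (shiftEquiv hT hμ).apply_symm_apply (f : H)
  have h2 : dissipativeExtension T μ u = f - Complex.I • (u : H) := by rw [← h1]; module
  have h3 := dissipativeExtension_graph_le T μ u
  have h4 : shift (dissipativeExtension T μ) Complex.I u = f - (2 * Complex.I) • (u : H) := by
    change dissipativeExtension T μ u - Complex.I • (u : H) = _
    rw [h2]; module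
  rw [h4, mem_defect]
  have h5 := T†.graph.sub_mem (mem_defect.1 f.2) (T†.graph.smul_mem (2 * Complex.I) h3)
  convert h5 using 1
  refine Prod.ext rfl ?_
  change (-Complex.I) • ((f : H) - (2 * Complex.I) • (u : H)) =
    Complex.I • (f : H) - (2 * Complex.I) • dissipativeExtension T μ u
  rw [h2]
  module

/-- The Straus characteristic function of a closed densely defined symmetric operator `T`,
`Sh(μ) = (A_μ - i) (A_μ + i)⁻¹ ↾ ker (T* - i)`, with values in `ker (T* + i)`. -/
def straus {T : H →ₗ.[ℂ] H} (hT : IsClosedSymmetric T) (μ : ℂ) (hμ : 0 < μ.im) :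
    defect T Complex.I →ₗ[ℂ] defect T (-Complex.I) :=
  LinearMap.codRestrict (defect T (-Complex.I))
    (shift (dissipativeExtension T μ) Complex.I ∘ₗ (shiftEquiv hT hμ).symm.toLinearMap ∘ₗ
      (defect T Complex.I).subtype)
    (shift_mem_defect hT hμ)

end Hilbert

/-! ### Fundamental symmetries -/

/-- A non-trivial fundamental symmetry: `J = J*`, `J² = I`, `J ≠ ± I`. -/
structure FundamentalSymmetry (H : Type*) [NormedAddCommGroup H] [InnerProductSpace ℂ H]
    [CompleteSpace H] where
  op : H →L[ℂ] H
  selfAdjoint : IsSelfAdjoint op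
  sq : ∀ x, op (op x) = x
  ne_id : op ≠ ContinuousLinearMap.id ℂ H
  ne_neg_id : op ≠ -ContinuousLinearMap.id ℂ H

section Krein

variable {H : Type*} [NormedAddCommGroup H] [InnerProductSpace ℂ H] [CompleteSpace H]

namespace FundamentalSymmetry

variable (J : FundamentalSymmetry H)

/-- `P₊ = (I + J) / 2`. -/
def projPlus : H →L[ℂ] H := (2⁻¹ : ℂ) • (ContinuousLinearMap.id ℂ H + J.op)

/-- `P₋ = (I - J) / 2`. -/
def projMinus : H →L[ℂ] H := (2⁻¹ : ℂ) • (ContinuousLinearMap.id ℂ H - J.op)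

/-- The positive part `P₊ H` of the fundamental decomposition. -/
def plus : Submodule ℂ H := J.projPlus.range

/-- The negative part `P₋ H` of the fundamental decomposition. -/
def minus : Submodule ℂ H := J.projMinus.range

theorem projPlus_apply (x : H) : J.projPlus x = (2⁻¹ : ℂ) • (x + J.op x) := rfl

theorem projMinus_apply (x : H) : J.projMinus x = (2⁻¹ : ℂ) • (x - J.op x) := rfl

theorem mem_plus {x : H} : x ∈ J.plus ↔ J.op x = x := by
  constructor
  · rintro ⟨y, rfl⟩
    change J.op (J.projPlus y) = J.projPlus y
    rw [projPlus_apply, map_smul, map_add, J.sq, add_comm]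
  · intro h
    refine ⟨x, ?_⟩
    change J.projPlus x = x
    rw [projPlus_apply, h]
    module

theorem mem_minus {x : H} : x ∈ J.minus ↔ J.op x = -x := by
  constructor
  · rintro ⟨y, rfl⟩
    change J.op (J.projMinus y) = -J.projMinus y
    rw [projMinus_apply, map_smul, map_sub, J.sq]
    module
  · intro h
    refine ⟨x, ?_⟩
    change J.projMinus x = x
    rw [projMinus_apply, h]
    module

instance : CompleteSpace J.plus := by
  have h : IsClosed (J.plus : Set H) := by
    have : (J.plus : Set H) = {x | J.op x = x} := Set.ext fun x => J.mem_plus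
    rw [this]
    exact isClosed_eq (by fun_prop) (by fun_prop)
  exact h.completeSpace_coe

instance : CompleteSpace J.minus := by
  have h : IsClosed (J.minus : Set H) := by
    have : (J.minus : Set H) = {x | J.op x = -x} := Set.ext fun x => J.mem_minus
    rw [this]
    exact isClosed_eq (by fun_prop) (by fun_prop)
  exact h.completeSpace_coe

/-- The indefinite inner product `[x, y] = (J x, y)`. -/
def form (x y : H) : ℂ := inner ℂ (J.op x) y

/-- `A` is `J`-self-adjoint: it is densely defined and equal to its adjoint with respect to the
indefinite inner product, the operator whose graph consists of the pairs `(x, y)` such that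
`[A u, x] = [u, y]` for all `u ∈ D(A)`. -/
def IsJSelfAdjoint (A : H →ₗ.[ℂ] H) : Prop :=
  Dense (A.domain : Set H) ∧
  ∀ x y : H, (x, y) ∈ A.graph ↔ ∀ u : A.domain, J.form (A u) x = J.form u y

/-- The operator identity `S J = J S`, equality of domains included. -/
def Commutes (S : H →ₗ.[ℂ] H) : Prop :=
  (∀ x : H, J.op x ∈ S.domain ↔ x ∈ S.domain) ∧
  ∀ (x : H) (hJx : J.op x ∈ S.domain) (hx : x ∈ S.domain), S ⟨J.op x, hJx⟩ = J.op (S ⟨x, hx⟩)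

variable {J} {S : H →ₗ.[ℂ] H}

theorem Commutes.invariant_plus (h : J.Commutes S) (x : S.domain) (hx : (x : H) ∈ J.plus) :
    S x ∈ J.plus := by
  have h1 := J.mem_plus.1 hx
  have h2 : J.op (x : H) ∈ S.domain := (h.1 x).2 x.2
  rw [J.mem_plus, ← h.2 x h2 x.2]
  exact congrArg S (Subtype.ext h1)

theorem Commutes.invariant_minus (h : J.Commutes S) (x : S.domain) (hx : (x : H) ∈ J.minus) :
    S x ∈ J.minus := by
  have h1 := J.mem_minus.1 hx
  have h2 : J.op (x : H) ∈ S.domain := (h.1 x).2 x.2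
  rw [J.mem_minus, ← h.2 x h2 x.2, ← LinearPMap.map_neg]
  exact congrArg S (Subtype.ext h1)

end FundamentalSymmetry

/-- `S₊ = S ↾ H₊`, an operator in `H₊`. -/
def plusPart (S : H →ₗ.[ℂ] H) {J : FundamentalSymmetry H} (h : J.Commutes S) :
    J.plus →ₗ.[ℂ] J.plus :=
  restrict S J.plus h.invariant_plus

/-- `S₋ = S ↾ H₋`, an operator in `H₋`. -/
def minusPart (S : H →ₗ.[ℂ] H) {J : FundamentalSymmetry H} (h : J.Commutes S) :
    J.minus →ₗ.[ℂ] J.minus :=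
  restrict S J.minus h.invariant_minus

theorem IsClosedSymmetric.plusPart {S : H →ₗ.[ℂ] H} (hS : IsClosedSymmetric S)
    {J : FundamentalSymmetry H} (h : J.Commutes S) : IsClosedSymmetric (plusPart S h) :=
  restrict_isClosedSymmetric hS J.projPlus
    (fun x hx => S.domain.smul_mem _ (S.domain.add_mem hx ((h.1 x).2 hx))) h.invariant_plus

theorem IsClosedSymmetric.minusPart {S : H →ₗ.[ℂ] H} (hS : IsClosedSymmetric S)
    {J : FundamentalSymmetry H} (h : J.Commutes S) : IsClosedSymmetric (minusPart S h) :=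
  restrict_isClosedSymmetric hS J.projMinus
    (fun x hx => S.domain.smul_mem _ (S.domain.sub_mem hx ((h.1 x).2 hx))) h.invariant_minus

end Krein

end KreinExt

end

/-! The four vectors spanning the defect spaces of `S` at `i` and `-i` give each element of `D(S*)`
boundary values in `ℂ⁴`, determined modulo `D(S)`. In these coordinates the failure of `J`-symmetry
of `S*` is, up to a nonzero factor, the form with signs `(+,-,-,+)` (`form_add_comb`). Hence the
`J`-self-adjoint extensions of `S` are the restrictions of `S*` to boundary values in a Lagrangian
subspace `L`, and `dim L = 2` (`isJSelfAdjoint_extension`, `mem_comap_comb_iff`, `finrank_eq_two`).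

The space `ker (S* - μ)` has as boundary values the plane `N_μ` of vectors `(α, -α s, β, -β t)`,
where `s = s₊(μ)` and `t = s₋(μ)`. If `L ∩ N_μ = 0`, then `L ⊕ N_μ = ℂ⁴` and `A - μ` is bijective.
So an empty resolvent set forces `L` to meet every `N_μ` (`exists_strausVector_mem`).

Since `s₊(i) = s₋(i) = 0`, the plane `N_i` gives `(α, 0, β, 0) ∈ L` with `|α| = |β| ≠ 0`. Neutrality
against this vector makes the pair found at any other `μ` proportional to `(α, β)`. Neutrality
between two points then gives `conj s₊(ν) s₊(μ) = conj s₋(ν) s₋(μ)`, which is proportionality with a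
unimodular constant (`exists_unimodular`).

Conversely, if `c s₊ = s₋`, the Lagrangian plane `a₂ = a₀`, `a₃ = c a₁` meets every `N_μ`. All of
the upper half plane then consists of eigenvalues; the real line is excluded as their limit, and the
lower half plane by `J`-symmetry (`exists_extension`). -/

noncomputable section

namespace KreinExt

/-! ### Closed symmetric operators: ranges, defect spaces, von Neumann decomposition. -/

section Hilbert

variable {H : Type*} [NormedAddCommGroup H] [InnerProductSpace ℂ H]

/-- A resolvent point has a neighbourhood without eigenvalues. -/
theorem notMem_resolventSet_of_eigenvalues {A : H →ₗ.[ℂ] H} {z : ℂ}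
    (h : ∀ ε : ℝ, 0 < ε → ∃ (μ : ℂ) (x : A.domain),
      ‖μ - z‖ ≤ ε ∧ (x : H) ≠ 0 ∧ A x = μ • (x : H)) : z ∉ resolventSet A := by
  rintro ⟨R, -, hR⟩
  have hR0 : 0 < ‖R‖ + 1 := by positivity
  obtain ⟨μ, x, hμ, hx, hAx⟩ := h (2 * (‖R‖ + 1))⁻¹ (by positivity)
  have h1 := hR x
  rw [hAx, ← sub_smul, map_smul] at h1
  have hx0 : 0 < ‖(x : H)‖ := norm_pos_iff.2 hx
  have h2 : ‖(x : H)‖ ≤ (2 * (‖R‖ + 1))⁻¹ * ((‖R‖ + 1) * ‖(x : H)‖) := by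
    calc ‖(x : H)‖ = ‖μ - z‖ * ‖R x‖ := by rw [← norm_smul, h1]
      _ ≤ (2 * (‖R‖ + 1))⁻¹ * ((‖R‖ + 1) * ‖(x : H)‖) := by
        gcongr
        exact (R.le_opNorm _).trans (by gcongr; linarith)
  have h3 : (2 * (‖R‖ + 1))⁻¹ * ((‖R‖ + 1) * ‖(x : H)‖) = ‖(x : H)‖ / 2 := by
    field_simp
  linarith

variable [CompleteSpace H] {T : H →ₗ.[ℂ] H}

theorem IsClosedSymmetric.graph_le_adjoint (hT : IsClosedSymmetric T) (u : T.domain) :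
    ((u : H), T u) ∈ T†.graph :=
  LinearPMap.le_graph_of_le (hT.symmetric.le_adjoint hT.dense) (T.mem_graph u)

/-- For nonreal `z` the range of `T - z` is closed, so it splits the space orthogonally, and its
orthogonal complement lies in `ker (T* - conj z)`. -/
theorem IsClosedSymmetric.exists_range_add_defect (hT : IsClosedSymmetric T) {z : ℂ}
    (hz : z.im ≠ 0) (f : H) :
    ∃ (u : T.domain) (n : H), n ∈ defect T ((starRingEnd ℂ) z) ∧ f = T u - z • (u : H) + n := by
  have : CompleteSpace (LinearMap.range (shift T z)) :=
    (hT.isClosed_range_sub hz).completeSpace_coe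
  obtain ⟨y, ⟨u, rfl⟩, n, hn, rfl⟩ :=
    (LinearMap.range (shift T z)).exists_add_mem_mem_orthogonal f
  refine ⟨u, n, mem_defect_of_orthogonal hT.dense fun x => ?_, rfl⟩
  rw [Complex.conj_conj]
  exact (Submodule.mem_orthogonal _ _).1 hn _ ⟨x, rfl⟩

/-- `T* - z` is onto for nonreal `z`. -/
theorem IsClosedSymmetric.exists_adjoint_sub_eq (hT : IsClosedSymmetric T) {z : ℂ}
    (hz : z.im ≠ 0) (f : H) : ∃ g h : H, (g, h) ∈ T†.graph ∧ f = h - z • g := by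
  obtain ⟨u, n, hn, rfl⟩ := hT.exists_range_add_defect hz f
  have hzz : (starRingEnd ℂ) z - z ≠ 0 := by
    intro h
    have := congrArg Complex.im h
    simp at this
    exact hz (by linarith)
  refine ⟨_, _, T†.graph.add_mem (hT.graph_le_adjoint u)
    (T†.graph.smul_mem ((starRingEnd ℂ) z - z)⁻¹ (mem_defect.1 hn)), ?_⟩
  have h1 : n = (((starRingEnd ℂ) z - z)⁻¹ * ((starRingEnd ℂ) z - z)) • n := by
    rw [inv_mul_cancel₀ hzz, one_smul]
  change _ = T u + ((starRingEnd ℂ) z - z)⁻¹ • (starRingEnd ℂ) z • n -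
    z • ((u : H) + ((starRingEnd ℂ) z - z)⁻¹ • n)
  nth_rewrite 1 [h1]
  module

/-- The first von Neumann formula. -/
theorem IsClosedSymmetric.exists_decomposition (hT : IsClosedSymmetric T) {x y : H}
    (hxy : (x, y) ∈ T†.graph) : ∃ (u : T.domain) (n m : H), n ∈ defect T Complex.I ∧
      m ∈ defect T (-Complex.I) ∧ x = u + n + m := by
  -- Splitting `(T* + i) x` finds `u`. As `T* + i` acts on `ker (T* - i)` as `2i`, the component
  -- there is `n / (2i)`, and what remains of `x` is killed by `T* + i`.
  obtain ⟨u, n, hn, h⟩ := hT.exists_range_add_defect (z := -Complex.I) (by simp)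
    (y + Complex.I • x)
  have hn' : n ∈ defect T Complex.I := by simpa using hn
  have h2 : (2 * Complex.I : ℂ)⁻¹ * (2 * Complex.I) = 1 :=
    inv_mul_cancel₀ (mul_ne_zero two_ne_zero Complex.I_ne_zero)
  refine ⟨u, (2 * Complex.I : ℂ)⁻¹ • n, x - u - (2 * Complex.I : ℂ)⁻¹ • n,
    Submodule.smul_mem _ _ hn', ?_, by abel⟩
  have h3 := T†.graph.sub_mem (T†.graph.sub_mem hxy (hT.graph_le_adjoint u))
    (T†.graph.smul_mem (2 * Complex.I : ℂ)⁻¹ (mem_defect.1 hn'))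
  rw [mem_defect]
  convert h3 using 1
  refine Prod.ext rfl ?_
  have h4 : y = T u + Complex.I • (u : H) + n - Complex.I • x := by
    rw [eq_sub_iff_add_eq, h]; module
  change (-Complex.I) • (x - u - (2 * Complex.I : ℂ)⁻¹ • n) =
    y - T u - (2 * Complex.I : ℂ)⁻¹ • Complex.I • n
  have h5 : n = (2 * Complex.I : ℂ)⁻¹ • (2 * Complex.I) • n := by
    rw [smul_smul, h2, one_smul]
  rw [h4]
  nth_rewrite 2 [h5]
  module

/-- The vector `u - n = -m` lies in `D(A_μ)` and is killed by `A_μ + i`, so the basic estimate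
bounds `Im μ ‖n‖²` by zero. This gives uniqueness modulo `D(T) + ker (T* + i)`. -/
theorem IsClosedSymmetric.eq_zero_of_mem_defect (hT : IsClosedSymmetric T) {μ : ℂ}
    (hμ : 0 < μ.im) {n m : H} (hn : n ∈ defect T μ) (u : T.domain)
    (hm : m ∈ defect T (-Complex.I)) (h : n = u + m) : n = 0 := by
  have h1 : T u + (-Complex.I) • m = μ • n :=
    LinearPMap.mem_graph_snd_inj _ (T†.graph.add_mem (hT.graph_le_adjoint u) (mem_defect.1 hm))
      (mem_defect.1 hn) h.symm
  have h2 := (hT.bound hμ u (Submodule.neg_mem _ hn)).2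
  have h3 : T u + Complex.I • (u : H) + (μ + Complex.I) • (-n) = 0 := by
    have h4 : T u = μ • n + Complex.I • m := by rw [← h1]; module
    have h5 : (u : H) = n - m := by rw [h]; abel
    rw [h4, h5]; module
  rw [h3, norm_zero, norm_neg] at h2
  have h4 : ‖n‖ ^ 2 ≤ 0 := by nlinarith [sq_nonneg ‖n‖]
  have h5 : ‖n‖ ^ 2 = 0 := le_antisymm h4 (sq_nonneg _)
  simpa using h5

/-- The value `s` of the characteristic function is determined by
`e - s e' ∈ D(T) + ker (T* - μ)`. -/
theorem exists_of_straus_eq (hT : IsClosedSymmetric T) {μ : ℂ} (hμ : 0 < μ.im)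
    {e : defect T Complex.I} {e' : defect T (-Complex.I)} {s : ℂ}
    (h : straus hT μ hμ e = s • e') :
    ∃ (u : T.domain) (n : H), n ∈ defect T μ ∧ (e : H) - s • (e' : H) = u + n := by
  set v := (shiftEquiv hT hμ).symm e with hv
  have h1 : dissipativeExtension T μ v - (-Complex.I) • (v : H) = e :=
    (shiftEquiv hT hμ).apply_symm_apply (e : H)
  have h2 : dissipativeExtension T μ v - Complex.I • (v : H) = s • (e' : H) :=
    congrArg Subtype.val h
  obtain ⟨u, n, hn, hun⟩ := (mem_dissipativeExtension_domain hT).1 v.2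
  refine ⟨(2 * Complex.I) • u, (2 * Complex.I) • n, Submodule.smul_mem _ _ hn, ?_⟩
  rw [← h1, ← h2, Submodule.coe_smul, ← smul_add, ← hun]
  module

/-- Pairing `T (e - e') = i e + i e'` with `e` by the adjoint relation cancels the terms in `(e',
e)` and leaves `2i ‖e‖² = 0`. -/
theorem IsClosedSymmetric.eq_zero_of_sub_mem_domain (hT : IsClosedSymmetric T)
    {e e' : H} (he : e ∈ defect T Complex.I) (he' : e' ∈ defect T (-Complex.I))
    (h : e - e' ∈ T.domain) : e = 0 := by
  have h1 : T ⟨e - e', h⟩ = Complex.I • e - (-Complex.I) • e' :=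
    LinearPMap.mem_graph_snd_inj _ (hT.graph_le_adjoint ⟨e - e', h⟩)
      (T†.graph.sub_mem (mem_defect.1 he) (mem_defect.1 he')) rfl
  have h2 := (mem_adjoint_graph hT.dense).1 (mem_defect.1 he) ⟨e - e', h⟩
  rw [h1] at h2
  simp only [inner_sub_left, inner_smul_left, inner_smul_right, map_neg, Complex.conj_I] at h2
  have h3 : (-(2 * Complex.I)) * inner ℂ e e = 0 := by linear_combination h2
  simpa using h3

/-- A closed operator with `A - μ` bijective has `μ` in its resolvent set. -/
theorem mem_resolventSet_of_bijective {A : H →ₗ.[ℂ] H} (hA : A.IsClosed) {μ : ℂ}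
    (hinj : ∀ x : A.domain, A x - μ • (x : H) = 0 → (x : H) = 0)
    (hsurj : ∀ y : H, ∃ x : A.domain, A x - μ • (x : H) = y) : μ ∈ resolventSet A := by
  have : CompleteSpace A.graph := hA.completeSpace_coe
  let F : A.graph →L[ℂ] H :=
    (ContinuousLinearMap.snd ℂ H H - μ • ContinuousLinearMap.fst ℂ H H) ∘L A.graph.subtypeL
  have hker : F.ker = ⊥ := by
    refine LinearMap.ker_eq_bot'.2 ?_
    rintro ⟨⟨a, b⟩, hab⟩ h
    obtain ⟨x, rfl, rfl⟩ := A.mem_graph_iff.1 hab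
    have hx : x = 0 := Subtype.ext (hinj x h)
    subst hx
    simp
  have hrange : F.range = ⊤ := by
    refine LinearMap.range_eq_top.2 fun y => ?_
    obtain ⟨x, hx⟩ := hsurj y
    exact ⟨⟨((x : H), A x), A.mem_graph x⟩, hx⟩
  -- The graph of a closed operator is a Banach space, so the open mapping theorem inverts `A - μ`
  -- boundedly into the graph; the first component of this inverse is the resolvent.
  let E := ContinuousLinearEquiv.ofBijective F hker hrange
  refine ⟨ContinuousLinearMap.fst ℂ H H ∘L A.graph.subtypeL ∘L (E.symm : H →L[ℂ] A.graph),
    fun y => ?_, fun x => ?_⟩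
  · obtain ⟨x, hx⟩ := hsurj y
    have h1 : E.symm y = ⟨((x : H), A x), A.mem_graph x⟩ := by
      rw [ContinuousLinearEquiv.symm_apply_eq]; exact hx.symm
    simp only [ContinuousLinearMap.comp_apply, ContinuousLinearEquiv.coe_coe, h1]
    exact ⟨x.2, hx⟩
  · have h1 : E.symm (A x - μ • (x : H)) = ⟨((x : H), A x), A.mem_graph x⟩ := by
      rw [ContinuousLinearEquiv.symm_apply_eq]; rfl
    simp only [ContinuousLinearMap.comp_apply, ContinuousLinearEquiv.coe_coe, h1]
    rfl

end Hilbert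

/-! ### Defect spaces of `S` and of its two parts. -/

section Krein

variable {H : Type*} [NormedAddCommGroup H] [InnerProductSpace ℂ H] [CompleteSpace H]
  {J : FundamentalSymmetry H} {S : H →ₗ.[ℂ] H}

theorem FundamentalSymmetry.inner_op (J : FundamentalSymmetry H) (x y : H) :
    inner ℂ (J.op x) y = inner ℂ x (J.op y) := by
  rw [← ContinuousLinearMap.adjoint_inner_right, J.selfAdjoint.adjoint_eq]

theorem FundamentalSymmetry.projPlus_add_projMinus (J : FundamentalSymmetry H) (x : H) :
    J.projPlus x + J.projMinus x = x := by
  rw [J.projPlus_apply, J.projMinus_apply]; module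

theorem FundamentalSymmetry.Commutes.adjoint (hSJ : J.Commutes S) (hS : Dense (S.domain : Set H))
    {x y : H} (h : (x, y) ∈ S†.graph) : (J.op x, J.op y) ∈ S†.graph := by
  rw [mem_adjoint_graph hS] at h ⊢
  intro u
  have hu := (hSJ.1 u).2 u.2
  rw [← J.inner_op, ← J.inner_op, ← hSJ.2 u hu u.2]
  exact h ⟨_, hu⟩

theorem op_mem_defect (hSJ : J.Commutes S) (hS : Dense (S.domain : Set H)) {z : ℂ} {x : H}
    (h : x ∈ defect S z) : J.op x ∈ defect S z := by
  rw [mem_defect, ← map_smul]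
  exact hSJ.adjoint hS h

/-- A test vector `u` in `D(S)` may be replaced by `P₊ u`: the projection commutes with `S`, and
pairing with a vector of `H₊` does not see the rest. -/
theorem mem_defect_of_mem_defect_plusPart (hS : IsClosedSymmetric S) (hSJ : J.Commutes S) {z : ℂ}
    {x : J.plus} (h : x ∈ defect (plusPart S hSJ) z) : (x : H) ∈ defect S z := by
  rw [mem_defect, mem_adjoint_graph (hS.plusPart hSJ).dense] at h
  rw [mem_defect, mem_adjoint_graph hS.dense]
  intro u
  have hJx : J.op (x : H) = x := J.mem_plus.1 x.2
  have hu := (hSJ.1 u).2 u.2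
  have hPu : J.projPlus u ∈ S.domain := S.domain.smul_mem _ (S.domain.add_mem u.2 hu)
  have h1 : inner ℂ (S ⟨J.projPlus u, hPu⟩) (x : H) = inner ℂ (J.projPlus (u : H)) (z • (x : H)) :=
    h ⟨⟨J.projPlus u, ⟨u, rfl⟩⟩, hPu⟩
  have h2 : S ⟨J.projPlus u, hPu⟩ = (2⁻¹ : ℂ) • (S u + J.op (S u)) := by
    rw [← hSJ.2 u hu u.2, ← LinearPMap.map_add, ← LinearPMap.map_smul]
    rfl
  rw [h2, J.projPlus_apply, inner_smul_left, inner_smul_left, inner_add_left, inner_add_left,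
    J.inner_op, J.inner_op, map_smul, hJx] at h1
  simp only [map_inv₀, map_ofNat] at h1
  linear_combination h1

theorem mem_defect_of_mem_defect_minusPart (hS : IsClosedSymmetric S) (hSJ : J.Commutes S) {z : ℂ}
    {x : J.minus} (h : x ∈ defect (minusPart S hSJ) z) : (x : H) ∈ defect S z := by
  rw [mem_defect, mem_adjoint_graph (hS.minusPart hSJ).dense] at h
  rw [mem_defect, mem_adjoint_graph hS.dense]
  intro u
  have hJx : J.op (x : H) = -x := J.mem_minus.1 x.2
  have hu := (hSJ.1 u).2 u.2
  have hPu : J.projMinus u ∈ S.domain := S.domain.smul_mem _ (S.domain.sub_mem u.2 hu)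
  have h1 : inner ℂ (S ⟨J.projMinus u, hPu⟩) (x : H) =
      inner ℂ (J.projMinus (u : H)) (z • (x : H)) :=
    h ⟨⟨J.projMinus u, ⟨u, rfl⟩⟩, hPu⟩
  have h2 : S ⟨J.projMinus u, hPu⟩ = (2⁻¹ : ℂ) • (S u - J.op (S u)) := by
    rw [← hSJ.2 u hu u.2, ← LinearPMap.map_sub, ← LinearPMap.map_smul]
    rfl
  rw [h2, J.projMinus_apply, inner_smul_left, inner_smul_left, inner_sub_left, inner_sub_left,
    J.inner_op, J.inner_op, map_smul, hJx, smul_neg, inner_neg_right, inner_neg_right] at h1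
  simp only [map_inv₀, map_ofNat] at h1
  linear_combination h1

theorem mem_defect_plusPart (hS : IsClosedSymmetric S) (hSJ : J.Commutes S) {z : ℂ}
    {x : J.plus} (h : (x : H) ∈ defect S z) : x ∈ defect (plusPart S hSJ) z := by
  rw [mem_defect, mem_adjoint_graph hS.dense] at h
  rw [mem_defect, mem_adjoint_graph (hS.plusPart hSJ).dense]
  exact fun u => h ⟨((u : J.plus) : H), u.2⟩

theorem mem_defect_minusPart (hS : IsClosedSymmetric S) (hSJ : J.Commutes S) {z : ℂ}
    {x : J.minus} (h : (x : H) ∈ defect S z) : x ∈ defect (minusPart S hSJ) z := by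
  rw [mem_defect, mem_adjoint_graph hS.dense] at h
  rw [mem_defect, mem_adjoint_graph (hS.minusPart hSJ).dense]
  exact fun u => h ⟨((u : J.minus) : H), u.2⟩

theorem exists_smul_eq_of_span {E : Type*} [AddCommGroup E] [Module ℂ E] {K : Submodule ℂ E}
    {e : K} (he : Submodule.span ℂ {e} = ⊤) {x : E} (hx : x ∈ K) : ∃ a : ℂ, x = a • (e : E) := by
  have h : (⟨x, hx⟩ : K) ∈ Submodule.span ℂ {e} := he ▸ Submodule.mem_top
  obtain ⟨a, ha⟩ := Submodule.mem_span_singleton.1 h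
  exact ⟨a, (congrArg Subtype.val ha).symm⟩

/-- The defect space of `S` is spanned by those of its two parts. -/
theorem exists_eq_of_mem_defect (hS : IsClosedSymmetric S) (hSJ : J.Commutes S) {z : ℂ}
    {e : defect (plusPart S hSJ) z} {f : defect (minusPart S hSJ) z}
    (he : Submodule.span ℂ {e} = ⊤) (hf : Submodule.span ℂ {f} = ⊤) {x : H}
    (hx : x ∈ defect S z) :
    ∃ a b : ℂ, x = a • ((e : J.plus) : H) + b • ((f : J.minus) : H) := by
  have hJx := op_mem_defect hSJ hS.dense hx
  have hp : J.projPlus x ∈ defect S z := Submodule.smul_mem _ _ (Submodule.add_mem _ hx hJx)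
  have hm : J.projMinus x ∈ defect S z := Submodule.smul_mem _ _ (Submodule.sub_mem _ hx hJx)
  obtain ⟨a, ha⟩ := exists_smul_eq_of_span he
    (mem_defect_plusPart hS hSJ (x := ⟨J.projPlus x, ⟨x, rfl⟩⟩) hp)
  obtain ⟨b, hb⟩ := exists_smul_eq_of_span hf
    (mem_defect_minusPart hS hSJ (x := ⟨J.projMinus x, ⟨x, rfl⟩⟩) hm)
  refine ⟨a, b, ?_⟩
  rw [← J.projPlus_add_projMinus x]
  exact congrArg₂ (· + ·) (congrArg Subtype.val ha) (congrArg Subtype.val hb)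

/-! ### Boundary values in `ℂ⁴` and the boundary form. -/

/-- Vectors of equal norm that span the defect spaces of the two parts of `S`; the first index is
the half plane, the second one the part. -/
structure DefectBasis (J : FundamentalSymmetry H) (S : H →ₗ.[ℂ] H) where
  (pp mp pm mm : H)
  r : ℝ
  r_pos : 0 < r
  op_pp : J.op pp = pp
  op_mp : J.op mp = mp
  op_pm : J.op pm = -pm
  op_mm : J.op mm = -mm
  norm_pp : ‖pp‖ = r
  norm_mp : ‖mp‖ = r
  norm_pm : ‖pm‖ = r
  norm_mm : ‖mm‖ = r
  pp_mem : pp ∈ defect S Complex.I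
  mp_mem : mp ∈ defect S (-Complex.I)
  pm_mem : pm ∈ defect S Complex.I
  mm_mem : mm ∈ defect S (-Complex.I)
  exists_eq_pos : ∀ x ∈ defect S Complex.I, ∃ a b : ℂ, x = a • pp + b • pm
  exists_eq_neg : ∀ x ∈ defect S (-Complex.I), ∃ a b : ℂ, x = a • mp + b • mm

namespace DefectBasis

variable (e : DefectBasis J S)

/-- The linear combinations of the defect vectors. -/
def comb : (EuclideanSpace ℂ (Fin 4)) →ₗ[ℂ] H where
  toFun a := a 0 • e.pp + a 1 • e.mp + a 2 • e.pm + a 3 • e.mm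
  map_add' a b := by simp only [PiLp.add_apply]; module
  map_smul' c a := by simp only [PiLp.smul_apply, RingHom.id_apply, smul_eq_mul]; module

/-- The image of `comb` under `S*`. -/
def adjComb (a : EuclideanSpace ℂ (Fin 4)) : H :=
  a 0 • Complex.I • e.pp + a 1 • (-Complex.I) • e.mp + a 2 • Complex.I • e.pm +
    a 3 • (-Complex.I) • e.mm

theorem comb_apply (a : EuclideanSpace ℂ (Fin 4)) :
    e.comb a = a 0 • e.pp + a 1 • e.mp + a 2 • e.pm + a 3 • e.mm := rfl

theorem comb_mem_graph (a : EuclideanSpace ℂ (Fin 4)) : (e.comb a, e.adjComb a) ∈ S†.graph :=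
  S†.graph.add_mem (S†.graph.add_mem (S†.graph.add_mem
    (S†.graph.smul_mem _ (mem_defect.1 e.pp_mem)) (S†.graph.smul_mem _ (mem_defect.1 e.mp_mem)))
    (S†.graph.smul_mem _ (mem_defect.1 e.pm_mem))) (S†.graph.smul_mem _ (mem_defect.1 e.mm_mem))

theorem exists_comb (hS : IsClosedSymmetric S) {x y : H} (h : (x, y) ∈ S†.graph) :
    ∃ (u : S.domain) (a : EuclideanSpace ℂ (Fin 4)), x = u + e.comb a ∧ y = S u + e.adjComb a := by
  obtain ⟨u, n, m, hn, hm, rfl⟩ := hS.exists_decomposition h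
  obtain ⟨a, b, rfl⟩ := e.exists_eq_pos n hn
  obtain ⟨a', b', rfl⟩ := e.exists_eq_neg m hm
  have h1 : (u : H) + (a • e.pp + b • e.pm) + (a' • e.mp + b' • e.mm) =
      u + e.comb !₂[a, a', b, b'] := by
    simp only [comb_apply]; simp; abel
  refine ⟨u, !₂[a, a', b, b'], h1, ?_⟩
  exact LinearPMap.mem_graph_snd_inj _ h
    (S†.graph.add_mem (hS.graph_le_adjoint u) (e.comb_mem_graph _)) h1

/-- The boundary form of `S*` in the coordinates given by the defect vectors. -/
def boundaryForm (a b : EuclideanSpace ℂ (Fin 4)) : ℂ :=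
  starRingEnd ℂ (a 0) * b 0 - starRingEnd ℂ (a 1) * b 1 - starRingEnd ℂ (a 2) * b 2 +
    starRingEnd ℂ (a 3) * b 3

theorem inner_eq_zero_of_op {x y : H} (hx : J.op x = x) (hy : J.op y = -y) : inner ℂ x y = 0 := by
  have h := J.inner_op x y
  rw [hx, hy, inner_neg_right] at h
  linear_combination h / 2

/-- Pairings between `H₊` and `H₋` vanish. Those of an `i`-vector with a `-i`-vector of the same
part need not vanish, but they cancel in the difference. The diagonal terms remain; their sign is
the product of the sign of the eigenvalue and that of `J`. -/
theorem form_comb (a b : EuclideanSpace ℂ (Fin 4)) :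
    J.form (e.adjComb a) (e.comb b) - J.form (e.comb a) (e.adjComb b) =
      -(2 * Complex.I * e.r ^ 2) * boundaryForm a b := by
  have h1 := inner_eq_zero_of_op e.op_pp e.op_pm
  have h2 := inner_eq_zero_of_op e.op_pp e.op_mm
  have h3 := inner_eq_zero_of_op e.op_mp e.op_pm
  have h4 := inner_eq_zero_of_op e.op_mp e.op_mm
  have h1' := inner_eq_zero_symm.1 h1
  have h2' := inner_eq_zero_symm.1 h2
  have h3' := inner_eq_zero_symm.1 h3
  have h4' := inner_eq_zero_symm.1 h4
  simp only [FundamentalSymmetry.form, comb_apply, adjComb, map_add, map_smul, e.op_pp, e.op_mp,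
    e.op_pm, e.op_mm, inner_add_left, inner_add_right, inner_smul_left, inner_smul_right,
    inner_neg_left, h1, h2, h3, h4, h1', h2', h3', h4', inner_self_eq_norm_sq_to_K, e.norm_pp,
    e.norm_mp, e.norm_pm, e.norm_mm, boundaryForm, map_neg, Complex.conj_I, Complex.coe_algebraMap]
  ring

/-- Since `J` commutes with `S`, this is the ordinary adjoint relation tested on `J u`. -/
theorem form_domain_left (hS : IsClosedSymmetric S) (hSJ : J.Commutes S) (u : S.domain) {x y : H}
    (h : (x, y) ∈ S†.graph) : J.form (S u) x = J.form u y := by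
  have hu := (hSJ.1 u).2 u.2
  have h1 := (mem_adjoint_graph hS.dense).1 h ⟨_, hu⟩
  rwa [hSJ.2 u hu u.2] at h1

theorem form_domain_right (hS : IsClosedSymmetric S) (hSJ : J.Commutes S) (u : S.domain) {x y : H}
    (h : (x, y) ∈ S†.graph) : J.form y u = J.form x (S u) := by
  have h1 := congrArg (starRingEnd ℂ) (form_domain_left hS hSJ u h)
  simp only [FundamentalSymmetry.form, inner_conj_symm] at h1
  rw [FundamentalSymmetry.form, FundamentalSymmetry.form, J.inner_op, J.inner_op, h1]

theorem form_add_comb (hS : IsClosedSymmetric S) (hSJ : J.Commutes S) (u v : S.domain)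
    (a b : EuclideanSpace ℂ (Fin 4)) :
    J.form (S u + e.adjComb a) (v + e.comb b) - J.form (u + e.comb a) (S v + e.adjComb b) =
      -(2 * Complex.I * e.r ^ 2) * boundaryForm a b := by
  have h1 := form_domain_left hS hSJ u
    (S†.graph.add_mem (hS.graph_le_adjoint v) (e.comb_mem_graph b))
  have h2 := form_domain_right hS hSJ v (e.comb_mem_graph a)
  rw [← e.form_comb]
  simp only [FundamentalSymmetry.form, map_add, inner_add_left, inner_add_right] at h1 h2 ⊢
  linear_combination h1 + h2

theorem form_factor_ne_zero : -(2 * Complex.I * (e.r : ℂ) ^ 2) ≠ 0 :=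
  neg_ne_zero.2 (mul_ne_zero (mul_ne_zero two_ne_zero Complex.I_ne_zero)
    (pow_ne_zero _ (Complex.ofReal_ne_zero.2 e.r_pos.ne')))

/-- Two elements of the graph of `S*` satisfy the `J`-symmetry relation if and only if their
boundary values are orthogonal with respect to the boundary form. -/
theorem form_eq_iff (hS : IsClosedSymmetric S) (hSJ : J.Commutes S) (u v : S.domain)
    (a b : EuclideanSpace ℂ (Fin 4)) :
    J.form (S u + e.adjComb a) (v + e.comb b) = J.form (u + e.comb a) (S v + e.adjComb b) ↔
      boundaryForm a b = 0 := by
  rw [← sub_eq_zero, e.form_add_comb hS hSJ, mul_eq_zero, or_iff_right e.form_factor_ne_zero]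

end DefectBasis

/-- A `J`-self-adjoint extension of `S` is a restriction of `S*`. -/
theorem FundamentalSymmetry.IsJSelfAdjoint.mem_adjoint_graph {A : H →ₗ.[ℂ] H}
    (hA : J.IsJSelfAdjoint A) (hS : IsClosedSymmetric S) (hSJ : J.Commutes S) (hSA : S ≤ A)
    (x : A.domain) : ((x : H), A x) ∈ S†.graph := by
  have h := (hA.2 x (A x)).1 (A.mem_graph x)
  rw [KreinExt.mem_adjoint_graph hS.dense]
  intro u
  have hu := (hSJ.1 u).2 u.2
  have h1 := h ⟨J.op u, hSA.1 hu⟩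
  rw [← hSA.2 (x := ⟨J.op u, hu⟩) rfl, hSJ.2 u hu u.2] at h1
  simpa only [FundamentalSymmetry.form, J.sq] using h1

theorem FundamentalSymmetry.IsJSelfAdjoint.isClosed {A : H →ₗ.[ℂ] H}
    (hA : J.IsJSelfAdjoint A) : A.IsClosed := by
  have h : (A.graph : Set (H × H)) =
      -- Being equal to its own `J`-adjoint presents the graph as an intersection of closed
      -- conditions.
      ⋂ u : A.domain, {p : H × H | J.form (A u) p.1 = J.form u p.2} := by
    ext ⟨x, y⟩
    simpa using hA.2 x y
  change IsClosed (A.graph : Set (H × H))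
  rw [h]
  refine isClosed_iInter fun u => isClosed_eq ?_ ?_ <;>
  · unfold FundamentalSymmetry.form
    fun_prop

end Krein

/-! ### Lagrangian subspaces and `J`-self-adjoint extensions. -/

section Krein

variable {H : Type*} [NormedAddCommGroup H] [InnerProductSpace ℂ H] [CompleteSpace H]
  {J : FundamentalSymmetry H} {S : H →ₗ.[ℂ] H}

namespace DefectBasis

variable (e : DefectBasis J S)

/-- The restriction of `S*` with boundary values in `W`. -/
def extension (W : Submodule ℂ (EuclideanSpace ℂ (Fin 4))) : H →ₗ.[ℂ] H :=
  S†.domRestrict (S.domain ⊔ W.map e.comb)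

variable {e} {W : Submodule ℂ (EuclideanSpace ℂ (Fin 4))}

theorem extension_graph_le (x : (e.extension W).domain) :
    ((x : H), e.extension W x) ∈ S†.graph :=
  LinearPMap.le_graph_of_le LinearPMap.domRestrict_le (LinearPMap.mem_graph _ x)

theorem mem_extension_graph (hS : IsClosedSymmetric S) {x y : H} :
    (x, y) ∈ (e.extension W).graph ↔
      ∃ (u : S.domain) (a : EuclideanSpace ℂ (Fin 4)), a ∈ W ∧ x = u + e.comb a ∧
        y = S u + e.adjComb a := by
  have hmem : ∀ (u : S.domain) (a : EuclideanSpace ℂ (Fin 4)),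
      ((u : H) + e.comb a, S u + e.adjComb a) ∈ S†.graph := fun u a =>
    S†.graph.add_mem (hS.graph_le_adjoint u) (e.comb_mem_graph a)
  constructor
  · intro h
    obtain ⟨v, rfl, rfl⟩ := (LinearPMap.mem_graph_iff _).1 h
    obtain ⟨u, hu, _, ⟨a, ha, rfl⟩, huv⟩ := Submodule.mem_sup.1 v.2.1
    exact ⟨⟨u, hu⟩, a, ha, huv.symm,
      LinearPMap.mem_graph_snd_inj _ (extension_graph_le v) (hmem ⟨u, hu⟩ a) huv.symm⟩
  · rintro ⟨u, a, ha, rfl, rfl⟩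
    have hd : (u : H) + e.comb a ∈ (e.extension W).domain :=
      ⟨Submodule.add_mem_sup u.2 (Submodule.mem_map_of_mem ha), LinearPMap.mem_domain_of_mem_graph (hmem u a)⟩
    have h := LinearPMap.mem_graph_snd_inj _ (extension_graph_le ⟨_, hd⟩) (hmem u a) rfl
    rw [← h]
    exact (e.extension W).mem_graph ⟨_, hd⟩

theorem le_extension (hS : IsClosedSymmetric S) : S ≤ e.extension W := by
  refine LinearPMap.le_of_le_graph ?_
  rintro ⟨x, y⟩ h
  obtain ⟨u, rfl, rfl⟩ := S.mem_graph_iff.1 h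
  exact (mem_extension_graph hS).2 ⟨u, 0, W.zero_mem, by simp, by simp [adjComb]⟩

/-- Lagrangian boundary conditions define a `J`-self-adjoint extension. -/
theorem isJSelfAdjoint_extension (hS : IsClosedSymmetric S) (hSJ : J.Commutes S)
    (hW : ∀ a, a ∈ W ↔ ∀ b ∈ W, boundaryForm b a = 0) : J.IsJSelfAdjoint (e.extension W) := by
  refine ⟨hS.dense.mono (le_extension hS).1, fun x y => ⟨fun h v => ?_, fun h => ?_⟩⟩
  · obtain ⟨u, a, ha, rfl, rfl⟩ := (mem_extension_graph hS).1 h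
    obtain ⟨w, b, hb, h1, h2⟩ := (mem_extension_graph hS).1 (LinearPMap.mem_graph _ v)
    rw [h1, h2, e.form_eq_iff hS hSJ]
    exact (hW a).1 ha b hb
  · have hform : ∀ (v : S.domain) (b : EuclideanSpace ℂ (Fin 4)), b ∈ W →
        J.form (S v + e.adjComb b) x = J.form (v + e.comb b) y := by
      intro v b hb
      obtain ⟨w, h1, h2⟩ := (LinearPMap.mem_graph_iff _).1
        ((mem_extension_graph (e := e) (W := W) hS).2 ⟨v, b, hb, rfl, rfl⟩)
      have h1' : (w : H) = v + e.comb b := h1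
      have h2' : e.extension W w = S v + e.adjComb b := h2
      rw [← h1', ← h2']
      exact h w
    have hxy : (x, y) ∈ S†.graph := by
      rw [mem_adjoint_graph hS.dense]
      intro u
      have hu := (hSJ.1 u).2 u.2
      -- Testing on `J u` with zero boundary value removes `J` from the form and leaves the defining
      -- relation of `S*`.
      have h1 := hform ⟨_, hu⟩ 0 W.zero_mem
      simp only [FundamentalSymmetry.form, hSJ.2 u hu u.2, map_add, J.sq] at h1
      simpa [adjComb] using h1
    obtain ⟨u, a, rfl, rfl⟩ := e.exists_comb hS hxy
    refine (mem_extension_graph hS).2 ⟨u, a, (hW a).2 fun b hb => ?_, rfl, rfl⟩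
    rw [← e.form_eq_iff hS hSJ 0 u]
    exact hform 0 b hb

/-- The boundary values of a `J`-self-adjoint extension form a Lagrangian subspace. -/
theorem mem_comap_comb_iff (hS : IsClosedSymmetric S) (hSJ : J.Commutes S) {A : H →ₗ.[ℂ] H}
    (hSA : S ≤ A) (hA : J.IsJSelfAdjoint A) (a : EuclideanSpace ℂ (Fin 4)) :
    a ∈ A.domain.comap e.comb ↔ ∀ b ∈ A.domain.comap e.comb, boundaryForm b a = 0 := by
  have hgraph : ∀ b (hb : e.comb b ∈ A.domain), A ⟨e.comb b, hb⟩ = e.adjComb b := fun b hb =>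
    LinearPMap.mem_graph_snd_inj _ (hA.mem_adjoint_graph hS hSJ hSA ⟨_, hb⟩)
      (e.comb_mem_graph b) rfl
  constructor
  · intro ha b hb
    have h := (hA.2 _ _).1 (A.mem_graph ⟨_, ha⟩) ⟨_, hb⟩
    rw [hgraph a ha, hgraph b hb] at h
    have h1 := e.form_comb b a
    rw [h, sub_self, zero_eq_mul] at h1
    exact h1.resolve_left e.form_factor_ne_zero
  · intro h
    refine LinearPMap.mem_domain_of_mem_graph (y := e.adjComb a) ((hA.2 _ _).2 fun v => ?_)
    obtain ⟨u, b, h1, h2⟩ := e.exists_comb hS (hA.mem_adjoint_graph hS hSJ hSA v)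
    have hb : b ∈ A.domain.comap e.comb := by
      have h3 : e.comb b = v - u := by rw [h1]; abel
      rw [Submodule.mem_comap, h3]
      exact A.domain.sub_mem v.2 (hSA.1 u.2)
    have h4 := (e.form_eq_iff hS hSJ u 0 b a).2 (h b hb)
    rw [h1, h2]
    simpa using h4

/-- A Lagrangian subspace has half the dimension of the whole space. -/
theorem finrank_eq_two (hW : ∀ a, a ∈ W ↔ ∀ b ∈ W, boundaryForm b a = 0) :
    Module.finrank ℂ W = 2 := by
  -- `G` is the Gram matrix of the boundary form, so `W` is the Euclidean orthogonal complement of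
  -- `G W`, which has the same dimension as `W`.
  let G : EuclideanSpace ℂ (Fin 4) →ₗ[ℂ] EuclideanSpace ℂ (Fin 4) :=
    { toFun := fun a => !₂[a 0, -a 1, -a 2, a 3]
      map_add' := fun a b => by ext i; fin_cases i <;> simp <;> ring
      map_smul' := fun c a => by ext i; fin_cases i <;> simp }
  have hG : Function.Injective G := by
    intro a b h
    have h0 := fun i => congrFun (congrArg WithLp.ofLp h) i
    ext i
    have := h0 i
    fin_cases i <;> simpa [G] using this
  have hperp : (W.map G)ᗮ = W := by
    ext a
    rw [hW, Submodule.mem_orthogonal]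
    have hin : ∀ b, inner ℂ (G b) a = boundaryForm b a := by
      intro b
      simp [G, PiLp.inner_apply, Fin.sum_univ_four, boundaryForm]
      ring
    constructor
    · exact fun h b hb => hin b ▸ h _ ⟨b, hb, rfl⟩
    · rintro h _ ⟨b, hb, rfl⟩
      exact (hin b).trans (h b hb)
  have h1 := (W.map G).finrank_add_finrank_orthogonal
  rw [hperp, (Submodule.equivMapOfInjective G hG W).finrank_eq.symm] at h1
  simp at h1
  omega

end DefectBasis

/-! ### Boundary values of `ker (S* - μ)` and the two implications. -/

/-- Vectors that realise `s` and `t` as the values of the characteristic functions of the two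
parts of `S` at the point `μ`. -/
structure DefectBasis.IsStrausAt (e : DefectBasis J S) (μ s t : ℂ) (n m : H) : Prop where
  plus_mem : n ∈ defect S μ
  minus_mem : m ∈ defect S μ
  op_plus : J.op n = n
  op_minus : J.op m = -m
  plus_ne_zero : n ≠ 0
  exists_plus : ∃ u : S.domain, e.pp - s • e.mp = u + n
  exists_minus : ∃ u : S.domain, e.pm - t • e.mm = u + m

namespace DefectBasis

variable {e : DefectBasis J S} {μ s t : ℂ} {n m : H}

/-- The boundary values of the elements of `ker (S* - μ)`. -/
def strausVector (s t α β : ℂ) : EuclideanSpace ℂ (Fin 4) := !₂[α, -(α * s), β, -(β * t)]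

theorem IsStrausAt.exists_comb_eq (h : e.IsStrausAt μ s t n m) (α β : ℂ) :
    ∃ u : S.domain, e.comb (strausVector s t α β) = u + (α • n + β • m) := by
  obtain ⟨u, hu⟩ := h.exists_plus
  obtain ⟨v, hv⟩ := h.exists_minus
  refine ⟨α • u + β • v, ?_⟩
  calc e.comb (strausVector s t α β)
      = α • (e.pp - s • e.mp) + β • (e.pm - t • e.mm) := by
        simp [comb_apply, strausVector]; module
    _ = _ := by
      rw [hu, hv, Submodule.coe_add, Submodule.coe_smul, Submodule.coe_smul]; module

theorem IsStrausAt.mem_defect (h : e.IsStrausAt μ s t n m) (α β : ℂ) :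
    α • n + β • m ∈ defect S μ :=
  Submodule.add_mem _ (Submodule.smul_mem _ _ h.plus_mem) (Submodule.smul_mem _ _ h.minus_mem)

/-- Applying `P₊` to the sum recovers `n`. -/
theorem IsStrausAt.add_ne_zero (h : e.IsStrausAt μ s t n m) : n + m ≠ 0 := by
  intro h0
  have h1 := congrArg J.op h0
  rw [map_add, h.op_plus, h.op_minus, map_zero] at h1
  refine h.plus_ne_zero ?_
  have h2 : n = (2⁻¹ : ℂ) • ((n + m) + (n + -m)) := by module
  rw [h2, h0, h1]; simp

/-- Proportional characteristic functions produce an extension with empty resolvent set. -/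
theorem exists_extension (e : DefectBasis J S) (hS : IsClosedSymmetric S) (hSJ : J.Commutes S)
    {c : ℂ} (hc : ‖c‖ = 1) {s : ℂ → ℂ}
    (hs : ∀ μ : ℂ, 0 < μ.im → ∃ n m, e.IsStrausAt μ (s μ) (c * s μ) n m) :
    ∃ A : H →ₗ.[ℂ] H, S ≤ A ∧ J.IsJSelfAdjoint A ∧ resolventSet A = ∅ := by
  have hcc : starRingEnd ℂ c * c = 1 := by
    rw [mul_comm, Complex.mul_conj, Complex.normSq_eq_norm_sq, hc]; simp
  -- These equations hold for `(1, -s, 1, -c s)` whatever `s` is, and `|c| = 1` makes the plane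
  -- neutral.
  let W : Submodule ℂ (EuclideanSpace ℂ (Fin 4)) :=
    { carrier := {a | a 2 = a 0 ∧ a 3 = c * a 1}
      add_mem' := fun {a b} ha hb => by
        constructor
        · simp [ha.1, hb.1]
        · simp [ha.2, hb.2, mul_add]
      zero_mem' := by simp
      smul_mem' := fun k a ha => by
        constructor
        · simp [ha.1]
        · simp [ha.2]; ring }
  have hmemW : ∀ a, a ∈ W ↔ a 2 = a 0 ∧ a 3 = c * a 1 := fun a => Iff.rfl
  have hW : ∀ a, a ∈ W ↔ ∀ b ∈ W, boundaryForm b a = 0 := by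
    intro a
    constructor
    · intro ha b hb
      rw [hmemW] at ha hb
      rw [boundaryForm, ha.1, ha.2, hb.1, hb.2, map_mul]
      linear_combination (starRingEnd ℂ (b 1) * a 1) * hcc
    · intro h
      have h1 := h !₂[1, 0, 1, 0] ((hmemW _).2 (by simp))
      have h2 := h !₂[0, 1, 0, c] ((hmemW _).2 (by simp))
      simp [boundaryForm] at h1 h2
      refine (hmemW a).2 ⟨by linear_combination -h1, ?_⟩
      linear_combination c * h2 - a 3 * hcc
  have hA := e.isJSelfAdjoint_extension hS hSJ hW
  have heig : ∀ μ : ℂ, 0 < μ.im → ∃ x : (e.extension W).domain, (x : H) ≠ 0 ∧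
      e.extension W x = μ • (x : H) := by
    intro μ hμ
    obtain ⟨n, m, h⟩ := hs μ hμ
    obtain ⟨u, hu⟩ := h.exists_comb_eq 1 1
    have h1 : n + m = (-u : S.domain) + e.comb (strausVector (s μ) (c * s μ) 1 1) := by
      rw [hu]; simp
    have hgr := (mem_extension_graph (e := e) (W := W) hS).2
      ⟨-u, strausVector (s μ) (c * s μ) 1 1, (hmemW _).2 (by simp [strausVector]), h1, rfl⟩
    obtain ⟨x, hx, -⟩ := (LinearPMap.mem_graph_iff _).1 hgr
    have hx' : (x : H) = n + m := hx
    refine ⟨x, hx' ▸ h.add_ne_zero, ?_⟩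
    refine LinearPMap.mem_graph_snd_inj _ (extension_graph_le x) ?_ rfl
    rw [← KreinExt.mem_defect, hx']
    simpa using h.mem_defect 1 1
  refine ⟨e.extension W, le_extension hS, hA, Set.eq_empty_iff_forall_notMem.2 fun z => ?_⟩
  rcases lt_or_ge z.im 0 with hz | hz
  -- If `x` is an eigenvector for `conj z`, then `J x` is out of reach: `(A - z) y = J x` and `[A y,
  -- x] = [y, A x]` give `(x, x) = 0`.
  · rintro ⟨R, hR, -⟩
    obtain ⟨x, hx, hxz⟩ := heig (starRingEnd ℂ z) (by simpa using hz)
    obtain ⟨h, hy⟩ := hR (J.op x)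
    have h1 := (hA.2 _ _).1 (LinearPMap.mem_graph _ x) ⟨_, h⟩
    have h2 : e.extension W ⟨R (J.op x), h⟩ = J.op x + z • R (J.op x) :=
      sub_eq_iff_eq_add.1 hy
    rw [h2, hxz] at h1
    simp only [FundamentalSymmetry.form, map_add, map_smul, J.sq, inner_add_left, inner_smul_left,
      inner_smul_right] at h1
    have h3 : inner ℂ (x : H) (x : H) = 0 := by linear_combination h1
    exact hx (inner_self_eq_zero.1 h3)
  · refine notMem_resolventSet_of_eigenvalues fun ε hε => ?_
    obtain ⟨x, hx, hxz⟩ := heig (z + ε * Complex.I) (by simp; linarith)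
    exact ⟨_, x, by simp [abs_of_pos hε], hx, hxz⟩

/-- If the resolvent set of a `J`-self-adjoint extension is empty, then its boundary values meet
those of `ker (S* - μ)` for all `μ` in the upper half plane. -/
theorem exists_strausVector_mem (hS : IsClosedSymmetric S) (hSJ : J.Commutes S)
    {A : H →ₗ.[ℂ] H} (hSA : S ≤ A) (hA : J.IsJSelfAdjoint A) (hμ : 0 < μ.im)
    (hres : μ ∉ resolventSet A) (h : e.IsStrausAt μ s t n m) :
    ∃ α β : ℂ, (α ≠ 0 ∨ β ≠ 0) ∧ e.comb (strausVector s t α β) ∈ A.domain := by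
  by_contra! hcon
  have hind : ∀ α β : ℂ, e.comb (strausVector s t α β) ∈ A.domain → α = 0 ∧ β = 0 := by
    intro α β hαβ
    by_contra hne
    exact hcon α β (by tauto) hαβ
  have hgr := hA.mem_adjoint_graph hS hSJ hSA
  refine hres (mem_resolventSet_of_bijective hA.isClosed (fun x hx => ?_) fun f => ?_)
  · have hxd : (x : H) ∈ defect S μ := by
      rw [KreinExt.mem_defect, ← sub_eq_zero.1 hx]; exact hgr x
    obtain ⟨u, a, hxa, -⟩ := e.exists_comb hS (hgr x)
    -- The element of `ker (S* - μ)` with the same two coordinates at `i` differs from `x` by an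
    -- element of `D(S) + ker (S* + i)`, hence equals `x`. So `x` has boundary values in `N_μ`.
    obtain ⟨v, hv⟩ := h.exists_comb_eq (a 0) (a 2)
    have hdiff : (x : H) - (a 0 • n + a 2 • m) = (u + v : S.domain) +
        ((a 1 + a 0 * s) • e.mp + (a 3 + a 2 * t) • e.mm) := by
      have h1 : a 0 • n + a 2 • m = e.comb (strausVector s t (a 0) (a 2)) - v := by
        rw [hv]; abel
      rw [h1, hxa]
      simp [comb_apply, strausVector]
      module
    have hx0 := sub_eq_zero.1 (hS.eq_zero_of_mem_defect hμ
      (Submodule.sub_mem _ hxd (h.mem_defect (a 0) (a 2))) _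
      (Submodule.add_mem _ (Submodule.smul_mem _ _ e.mp_mem) (Submodule.smul_mem _ _ e.mm_mem))
      hdiff)
    obtain ⟨h0, h2⟩ := hind (a 0) (a 2) (by
      rw [hv, ← hx0]
      exact A.domain.add_mem (hSA.1 v.2) x.2)
    rw [hx0, h0, h2]; simp
  · set L := A.domain.comap e.comb with hL
    let M : (Fin 2 → ℂ) →ₗ[ℂ] EuclideanSpace ℂ (Fin 4) :=
      { toFun := fun p => strausVector s t (p 0) (p 1)
        map_add' := fun p q => by ext i; fin_cases i <;> simp [strausVector] <;> ring
        map_smul' := fun k p => by ext i; fin_cases i <;> simp [strausVector] <;> ring }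
    have hM : Function.Injective M := by
      refine (injective_iff_map_eq_zero M).2 fun p hp => ?_
      have h0 := fun i => congrFun (congrArg WithLp.ofLp hp) i
      have h00 := h0 0
      have h02 := h0 2
      simp [M, strausVector] at h00 h02
      ext i
      fin_cases i <;> simpa
    have hdisj : L ⊓ LinearMap.range M = ⊥ := by
      refine (Submodule.eq_bot_iff _).2 ?_
      rintro _ ⟨hl, p, rfl⟩
      obtain ⟨h0, h1⟩ := hind (p 0) (p 1) hl
      have : p = 0 := by ext i; fin_cases i <;> simpa
      rw [this, map_zero]
    have htop : L ⊔ LinearMap.range M = ⊤ := by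
      refine Submodule.eq_top_of_finrank_eq ?_
      have h1 := Submodule.finrank_sup_add_finrank_inf_eq L (LinearMap.range M)
      rw [hdisj, finrank_bot, finrank_eq_two (mem_comap_comb_iff hS hSJ hSA hA),
        LinearMap.finrank_range_of_inj hM] at h1
      simpa using h1
    -- Solve first with `S*`, then split the boundary value of `g` along `L ⊕ N_μ`. Modulo `D(S)`
    -- the second component comes from `ker (S* - μ)`, so dropping that kernel vector leaves `f`
    -- unchanged and puts the solution into `D(A)`.
    obtain ⟨g, k, hgk, rfl⟩ := hS.exists_adjoint_sub_eq hμ.ne' f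
    obtain ⟨u, a, rfl, rfl⟩ := e.exists_comb hS hgk
    obtain ⟨l, hl, _, ⟨p, rfl⟩, rfl⟩ :=
      Submodule.mem_sup.1 (show a ∈ L ⊔ LinearMap.range M from htop ▸ Submodule.mem_top)
    obtain ⟨v, hv⟩ := h.exists_comb_eq (p 0) (p 1)
    have hv' : e.comb (M p) = v + (p 0 • n + p 1 • m) := hv
    have hx : (u : H) + e.comb l + v ∈ A.domain :=
      A.domain.add_mem (A.domain.add_mem (hSA.1 u.2) hl) (hSA.1 v.2)
    refine ⟨⟨_, hx⟩, ?_⟩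
    have h1 : S u + e.adjComb (l + M p) = A ⟨_, hx⟩ + μ • (p 0 • n + p 1 • m) := by
      refine LinearPMap.mem_graph_snd_inj _ hgk (S†.graph.add_mem (hgr ⟨_, hx⟩)
        (KreinExt.mem_defect.1 (h.mem_defect (p 0) (p 1)))) ?_
      change _ = (u : H) + e.comb l + v + (p 0 • n + p 1 • m)
      rw [map_add, hv']; abel
    rw [h1, map_add, hv']
    module

/-- If the boundary values of a `J`-self-adjoint extension meet those of `ker (S* - μ)` for all
`μ` in the upper half plane, then the characteristic functions are proportional. -/
theorem exists_unimodular (hS : IsClosedSymmetric S) (hSJ : J.Commutes S)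
    {A : H →ₗ.[ℂ] H} (hSA : S ≤ A) (hA : J.IsJSelfAdjoint A) {s t : ℂ → ℂ}
    (hs : s Complex.I = 0) (ht : t Complex.I = 0)
    (h : ∀ μ : ℂ, 0 < μ.im → ∃ α β : ℂ, (α ≠ 0 ∨ β ≠ 0) ∧
      e.comb (strausVector (s μ) (t μ) α β) ∈ A.domain) :
    ∃ c : ℂ, ‖c‖ = 1 ∧ ∀ μ : ℂ, 0 < μ.im → c * s μ = t μ := by
  set L := A.domain.comap e.comb
  have hneutral : ∀ a ∈ L, ∀ b ∈ L, boundaryForm b a = 0 := fun a ha =>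
    (mem_comap_comb_iff hS hSJ hSA hA a).1 ha
  obtain ⟨α, β, hne, hI⟩ := h Complex.I (by simp)
  rw [hs, ht] at hI
  -- At `i` the vector is `(α, 0, β, 0)`, so its neutrality reads `|α|² = |β|²`.
  have hαβ := hneutral _ hI _ hI
  simp only [boundaryForm, strausVector] at hαβ
  simp at hαβ
  have hα : α ≠ 0 := by
    rintro rfl
    simp at hαβ
    simp_all
  have hβ : starRingEnd ℂ β * β ≠ 0 := by
    rw [← sub_eq_zero.1 hαβ]; simpa using hα
  have hvec : ∀ μ : ℂ, 0 < μ.im → strausVector (s μ) (t μ) α β ∈ L := by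
    intro μ hμ
    obtain ⟨γ, δ, hne', hmem⟩ := h μ hμ
    -- This reads `conj α γ = conj β δ`; with `|α| = |β|` it makes `(γ, δ)` proportional to `(α,
    -- β)`.
    have h1 := hneutral _ hmem _ hI
    simp only [boundaryForm, strausVector] at h1
    simp at h1
    have h2 : α * δ = β * γ := by
      have h3 : starRingEnd ℂ β * (α * δ - β * γ) = 0 := by
        linear_combination -α * h1 + γ * hαβ
      exact sub_eq_zero.1 ((mul_eq_zero.1 h3).resolve_left (left_ne_zero_of_mul hβ))
    have hγ : γ ≠ 0 := by
      rintro rfl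
      simp [hα] at h2
      simp [h2] at hne'
    have h3 : strausVector (s μ) (t μ) α β = (α / γ) • strausVector (s μ) (t μ) γ δ := by
      have h4 : α / γ * δ = β := by
        field_simp
        linear_combination h2
      have h5 : α / γ * γ = α := div_mul_cancel₀ _ hγ
      ext i
      fin_cases i
      · simp [strausVector, h5]
      · simp only [strausVector]; simp; linear_combination (-s μ) * h5
      · simp [strausVector, h4]
      · simp only [strausVector]; simp; linear_combination (-t μ) * h4
    rw [h3]
    exact L.smul_mem _ hmem
  have hrel : ∀ μ ν : ℂ, 0 < μ.im → 0 < ν.im →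
      starRingEnd ℂ (s ν) * s μ = starRingEnd ℂ (t ν) * t μ := by
    intro μ ν hμ hν
    -- With the same `α`, `β` at both points, `|α|² = |β|²` cancels the constant terms and factors
    -- out of the others.
    have h1 := hneutral _ (hvec μ hμ) _ (hvec ν hν)
    simp only [boundaryForm, strausVector] at h1
    simp at h1
    have h2 : (starRingEnd ℂ β * β) *
        (starRingEnd ℂ (s ν) * s μ - starRingEnd ℂ (t ν) * t μ) = 0 := by
      linear_combination -h1 + (1 - starRingEnd ℂ (s ν) * s μ) * hαβ
    exact sub_eq_zero.1 ((mul_eq_zero.1 h2).resolve_left hβ)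
  by_cases h0 : ∀ μ : ℂ, 0 < μ.im → s μ = 0
  · refine ⟨1, by simp, fun μ hμ => ?_⟩
    have h1 := hrel μ μ hμ hμ
    rw [h0 μ hμ] at h1 ⊢
    simp at h1 ⊢
    exact h1.symm
  · push Not at h0
    obtain ⟨ν, hν, hsν⟩ := h0
    have h1 := hrel ν ν hν hν
    have hst : ‖s ν‖ = ‖t ν‖ := by
      have h2 := congrArg norm h1
      simp only [norm_mul, RCLike.norm_conj] at h2
      exact (mul_self_inj (norm_nonneg _) (norm_nonneg _)).1 h2
    have htν : starRingEnd ℂ (t ν) ≠ 0 := by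
      rw [← norm_ne_zero_iff, RCLike.norm_conj, ← hst, norm_ne_zero_iff]; exact hsν
    -- The relation between `μ` and the fixed `ν` is divided by `conj t(ν)`; the case `μ = ν` gives
    -- modulus one.
    refine ⟨starRingEnd ℂ (s ν) / starRingEnd ℂ (t ν), ?_, fun μ hμ => ?_⟩
    · rw [norm_div, RCLike.norm_conj, RCLike.norm_conj, hst, div_self]
      rwa [← hst, norm_ne_zero_iff]
    · have h2 := hrel μ ν hμ hν
      field_simp
      linear_combination h2

end DefectBasis

end Krein

/-! ### Normalisation at `i`, and the passage from the two parts to `S`. -/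

section Krein

variable {H : Type*} [NormedAddCommGroup H] [InnerProductSpace ℂ H] [CompleteSpace H]
  {J : FundamentalSymmetry H} {S : H →ₗ.[ℂ] H}

/-- A relation `e - s e' ∈ D(T) + ker (T* - i)` forces `s e' = 0`: the characteristic function
vanishes at `i`. -/
theorem smul_eq_zero_of_straus_at_I {T : H →ₗ.[ℂ] H} (hT : IsClosedSymmetric T) {e e' : H}
    (he : e ∈ defect T Complex.I) (he' : e' ∈ defect T (-Complex.I)) {s : ℂ} {u : T.domain}
    {n : H} (hn : n ∈ defect T Complex.I) (h : e - s • e' = u + n) : s • e' = 0 := by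
  have hI : 0 < Complex.I.im := by simp
  have hm : s • e' ∈ defect T (-Complex.I) := Submodule.smul_mem _ _ he'
  -- The left side is in `ker (T* - i)`, so it vanishes. Then `s e'` lies in `D(T)` and is killed by
  -- `T + i`, which is injective.
  have h1 : e - n = u + s • e' := by
    rw [sub_eq_iff_eq_add, add_right_comm, ← h]; abel
  have h2 := hT.eq_zero_of_mem_defect hI (Submodule.sub_mem _ he hn) u hm h1
  have h3 : s • e' = (-u : T.domain) := by
    rw [h2] at h1
    rw [Submodule.coe_neg]
    exact eq_neg_of_add_eq_zero_right h1.symm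
  have h4 : T (-u) = (-Complex.I) • (s • e') :=
    LinearPMap.mem_graph_snd_inj _ (hT.graph_le_adjoint (-u)) (mem_defect.1 hm) h3.symm
  have h5 := (hT.bound hI (-u) (Submodule.zero_mem (defect T Complex.I))).1
  rw [h4, ← h3] at h5
  simpa using h5

/-- The basis of the defect spaces of `S` formed by spanning vectors of the defect spaces of its
two parts. -/
def DefectBasis.ofParts (hS : IsClosedSymmetric S) (hSJ : J.Commutes S)
    {epp : defect (plusPart S hSJ) Complex.I} {emp : defect (plusPart S hSJ) (-Complex.I)}
    {epm : defect (minusPart S hSJ) Complex.I} {emm : defect (minusPart S hSJ) (-Complex.I)}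
    (hepp : Submodule.span ℂ {epp} = ⊤) (hemp : Submodule.span ℂ {emp} = ⊤)
    (hepm : Submodule.span ℂ {epm} = ⊤) (hemm : Submodule.span ℂ {emm} = ⊤)
    (h0 : epp ≠ 0) (hnorm_mp : ‖emp‖ = ‖epp‖) (hnorm_pm : ‖epm‖ = ‖epp‖)
    (hnorm_mm : ‖emm‖ = ‖epp‖) : DefectBasis J S where
  pp := (epp : J.plus)
  mp := (emp : J.plus)
  pm := (epm : J.minus)
  mm := (emm : J.minus)
  r := ‖epp‖
  r_pos := norm_pos_iff.2 h0
  op_pp := J.mem_plus.1 (epp : J.plus).2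
  op_mp := J.mem_plus.1 (emp : J.plus).2
  op_pm := J.mem_minus.1 (epm : J.minus).2
  op_mm := J.mem_minus.1 (emm : J.minus).2
  norm_pp := rfl
  norm_mp := hnorm_mp
  norm_pm := hnorm_pm
  norm_mm := hnorm_mm
  pp_mem := mem_defect_of_mem_defect_plusPart hS hSJ epp.2
  mp_mem := mem_defect_of_mem_defect_plusPart hS hSJ emp.2
  pm_mem := mem_defect_of_mem_defect_minusPart hS hSJ epm.2
  mm_mem := mem_defect_of_mem_defect_minusPart hS hSJ emm.2
  exists_eq_pos _ hx := exists_eq_of_mem_defect hS hSJ hepp hepm hx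
  exists_eq_neg _ hx := exists_eq_of_mem_defect hS hSJ hemp hemm hx

end Krein

end KreinExt

end

theorem theorem3p1 {H : Type*} [NormedAddCommGroup H] [InnerProductSpace ℂ H] [CompleteSpace H]
    (J : KreinExt.FundamentalSymmetry H) (S : H →ₗ.[ℂ] H) (hS : KreinExt.IsClosedSymmetric S)
    (hSJ : J.Commutes S)
    (hplus : KreinExt.HasDeficiencyIndicesOneOne (KreinExt.plusPart S hSJ))
    (hminus : KreinExt.HasDeficiencyIndicesOneOne (KreinExt.minusPart S hSJ))
    (epp : KreinExt.defect (KreinExt.plusPart S hSJ) Complex.I)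
    (emp : KreinExt.defect (KreinExt.plusPart S hSJ) (-Complex.I))
    (epm : KreinExt.defect (KreinExt.minusPart S hSJ) Complex.I)
    (emm : KreinExt.defect (KreinExt.minusPart S hSJ) (-Complex.I))
    (hepp : Submodule.span ℂ {epp} = ⊤) (hemp : Submodule.span ℂ {emp} = ⊤)
    (hepm : Submodule.span ℂ {epm} = ⊤) (hemm : Submodule.span ℂ {emm} = ⊤)
    (hnorm_mp : ‖emp‖ = ‖epp‖) (hnorm_pm : ‖epm‖ = ‖epp‖) (hnorm_mm : ‖emm‖ = ‖epp‖)
    (splus sminus : ℂ → ℂ)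
    (hsplus : ∀ (μ : ℂ) (hμ : 0 < μ.im),
      KreinExt.straus (hS.plusPart hSJ) μ hμ epp = splus μ • emp)
    (hsminus : ∀ (μ : ℂ) (hμ : 0 < μ.im),
      KreinExt.straus (hS.minusPart hSJ) μ hμ epm = sminus μ • emm) :
    (∃ A : H →ₗ.[ℂ] H, S ≤ A ∧ J.IsJSelfAdjoint A ∧ KreinExt.resolventSet A = ∅) ↔
      ∃ c : ℂ, ‖c‖ = 1 ∧ ∀ μ : ℂ, 0 < μ.im → c * splus μ = sminus μ := by
  have h0 : epp ≠ 0 := by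
    rintro rfl
    rw [Submodule.span_zero_singleton] at hepp
    have := (Submodule.subsingleton_iff ℂ).1 (subsingleton_of_bot_eq_top hepp)
    exact zero_ne_one (Module.finrank_zero_of_subsingleton.symm.trans hplus.1)
  let e := KreinExt.DefectBasis.ofParts hS hSJ hepp hemp hepm hemm h0 hnorm_mp hnorm_pm hnorm_mm
  have hTp := hS.plusPart hSJ
  have hTm := hS.minusPart hSJ
  have hI : 0 < Complex.I.im := by simp
  have hstraus : ∀ μ : ℂ, 0 < μ.im → ∃ n m, e.IsStrausAt μ (splus μ) (sminus μ) n m := by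
    intro μ hμ
    obtain ⟨u, n, hn, hun⟩ := KreinExt.exists_of_straus_eq hTp hμ (hsplus μ hμ)
    obtain ⟨v, m, hm, hvm⟩ := KreinExt.exists_of_straus_eq hTm hμ (hsminus μ hμ)
    refine ⟨n, m, KreinExt.mem_defect_of_mem_defect_plusPart hS hSJ hn,
      KreinExt.mem_defect_of_mem_defect_minusPart hS hSJ hm, J.mem_plus.1 n.2, J.mem_minus.1 m.2,
      ?_, ⟨⟨((u : J.plus) : H), u.2⟩, congrArg Subtype.val hun⟩,
      ⟨⟨((v : J.minus) : H), v.2⟩, congrArg Subtype.val hvm⟩⟩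
    -- If `n = 0`, then `epp - s emp` would lie in the domain of `S₊`, which forces `epp = 0`.
    intro hn0
    have hn0' : n = 0 := Subtype.ext hn0
    rw [hn0', add_zero] at hun
    have h1 := hTp.eq_zero_of_sub_mem_domain epp.2 (Submodule.smul_mem _ (splus μ) emp.2)
      (hun ▸ u.2)
    exact h0 (Subtype.ext h1)
  have hne : ∀ {E : Type _} [NormedAddCommGroup E] (x : E), ‖x‖ = ‖epp‖ → x ≠ 0 :=
    fun x hx => norm_ne_zero_iff.1 (hx ▸ norm_ne_zero_iff.2 h0)
  have hsI : splus Complex.I = 0 := by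
    obtain ⟨u, n, hn, hun⟩ := KreinExt.exists_of_straus_eq hTp hI (hsplus _ hI)
    have h1 := KreinExt.smul_eq_zero_of_straus_at_I hTp epp.2 emp.2 hn hun
    exact (smul_eq_zero.1 h1).resolve_right (hne _ hnorm_mp)
  have htI : sminus Complex.I = 0 := by
    obtain ⟨u, n, hn, hun⟩ := KreinExt.exists_of_straus_eq hTm hI (hsminus _ hI)
    have h1 := KreinExt.smul_eq_zero_of_straus_at_I hTm epm.2 emm.2 hn hun
    exact (smul_eq_zero.1 h1).resolve_right (hne _ hnorm_mm)
  constructor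
  · rintro ⟨A, hSA, hA, hres⟩
    refine KreinExt.DefectBasis.exists_unimodular (e := e) hS hSJ hSA hA hsI htI fun μ hμ => ?_
    obtain ⟨n, m, hnm⟩ := hstraus μ hμ
    exact KreinExt.DefectBasis.exists_strausVector_mem hS hSJ hSA hA hμ (by simp [hres]) hnm
  · rintro ⟨c, hc, hcs⟩
    refine e.exists_extension hS hSJ hc (s := splus) fun μ hμ => ?_
    rw [hcs μ hμ]
    exact hstraus μ hμ
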